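/- Let $\mathbb{H}$ be the upper half plane, and let $M_*=\bigoplus_k M_k$ be the graded ring of modular forms for $\mathrm{SL}_2(\mathbb{Z})$. Let the Weyl group $W(F_4)$ act on $\mathbb{C}^4$ as the group generated by the reflections in $\pm e_i$, $\pm e_i\pm e_j$ $(i\neq j)$ and $\frac12(\pm1,\pm1,\pm1,\pm1)$, and let $W(D_4)\subset W(F_4)$ be the normal subgroup generated by the reflections in $\pm e_i\pm e_j$ $(i\ne j)$. Both $\mathrm{SL}_2(\mathbb{Z})/\Gamma(2)$ and $W(F_4)/W(D_4)$ are isomorphic to $S_3$; identify them by the isomorphism that carries the classes of $T=\begin{pmatrix}1&1\\0&1\end{pmatrix}$ and $S=\begin{pmatrix}0&-1\\1&0\end{pmatrix}$ to the classes of $$w_T=\mathrm{diag}(1,1,1,-1),\qquad w_S=\frac12\begin{pmatrix}1&1&1&-1\\1&1&-1&1\\1&-1&1&1\\-1&1&1&1\end{pmatrix},$$ and let $\mathcal{G}=\mathrm{SL}_2(\mathbb{Z})\times_{S_3}W(F_4)$ be the resulting fibre product. For $k\in\mathbb{Z}$ and $m\in\mathbb{Z}_{\ge0}$, a $D_4$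 triality invariant of weight $k$ and degree $m$ is a holomorphic function $\varphi:\mathbb{H}\times\mathbb{C}^4\to\mathbb{C}$ such that 1. for every $\tau$, $\varphi(\tau,z_1,z_2,z_3,z_4)$ is a homogeneous polynomial of degree $m$ in $z_1,\dots,z_4$; 2. $\varphi\left(\frac{a\tau+b}{c\tau+d},w(z)\right)=(c\tau+d)^k\varphi(\tau,z)$ for all $\left(\begin{pmatrix}a&b\\c&d\end{pmatrix},w\right)\in\mathcal{G}$; 3. for all $z_1,z_2,z_3\in\mathbb{C}$ and $\Lambda\in\mathbb{C}^*$, $|\varphi(\tau,z_1,z_2,z_3,q^{-1/2}\Lambda)|$ has a finite limit as $q\to0$, i.e. as $\mathrm{Im}\,\tau\to\infty$, where $q^{1/2}=e^{\pi i\tau}$. Let $R_{k,m}$ be the $\mathbb{C}$-vector space of these functions, and let $R_{*,m}=\bigoplus_{k\in\mathbb{Z}}R_{k,m}$, which is a graded module over $M_*$ under multiplication of functions. **Lemma.** For every $m\ge0$ the rank $r(m)$ of $R_{*,m}$ over $M_*$ (the maximal number of $M_*$-linearly independent elements) is finite, and $$\sum_{m=0}^\infty r(m)x^m=\frac{1}{(1-x^2)(1-x^4)^2(1-x^6)}.$$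 -/

import Mathlib

noncomputable section

open Matrix MatrixGroups UpperHalfPlane CongruenceSubgroup Filter Topology DirectSum

namespace Triality

/-- The reflection `x ↦ x - 2 (v ⬝ x) / (v ⬝ v) v` as a matrix. -/
def reflectionMatrix (v : Fin 4 → ℂ) : Matrix (Fin 4) (Fin 4) ℂ :=
  1 - (2 / (v ⬝ᵥ v)) • vecMulVec v v

/-- The group generated by the reflections in the vectors of `Φ`. -/
def reflectionGroup (Φ : Set (Fin 4 → ℂ)) : Subgroup (GL (Fin 4) ℂ) :=
  Subgroup.closure {g | ∃ v ∈ Φ, (g : Matrix (Fin 4) (Fin 4) ℂ) = reflectionMatrix v}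

/-- The roots of `D₄`: the vectors `± e_i ± e_j` with `i ≠ j`, i.e. the integral vectors of
squared length `2`. -/
def rootsD4 : Set (Fin 4 → ℂ) :=
  {v | (∀ i, ∃ n : ℤ, v i = n) ∧ v ⬝ᵥ v = 2}

/-- The roots of `F₄`: the roots of `D₄`, the vectors `± e_i` and the vectors
`(± 1, ± 1, ± 1, ± 1) / 2`. -/
def rootsF4 : Set (Fin 4 → ℂ) :=
  rootsD4 ∪ {v | ∃ i, v = Pi.single i 1 ∨ v = -Pi.single i 1} ∪
    {v | ∀ i, v i = 1 / 2 ∨ v i = -1 / 2}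

/-- The Weyl group `W(D₄)`. -/
def WD4 : Subgroup (GL (Fin 4) ℂ) := reflectionGroup rootsD4

/-- The Weyl group `W(F₄)`. -/
def WF4 : Subgroup (GL (Fin 4) ℂ) := reflectionGroup rootsF4

/-- The linear map that accompanies `τ ↦ τ + 1`. -/
def wT : GL (Fin 4) ℂ where
  val := !![1, 0, 0, 0; 0, 1, 0, 0; 0, 0, 1, 0; 0, 0, 0, -1]
  inv := !![1, 0, 0, 0; 0, 1, 0, 0; 0, 0, 1, 0; 0, 0, 0, -1]
  val_inv := by ext i j; fin_cases i <;> fin_cases j <;> simp [mul_apply, Fin.sum_univ_four]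
  inv_val := by ext i j; fin_cases i <;> fin_cases j <;> simp [mul_apply, Fin.sum_univ_four]

/-- The linear map that accompanies `τ ↦ -1 / τ`. -/
def wS : GL (Fin 4) ℂ where
  val := (1 / 2 : ℂ) • !![1, 1, 1, -1; 1, 1, -1, 1; 1, -1, 1, 1; -1, 1, 1, 1]
  inv := (1 / 2 : ℂ) • !![1, 1, 1, -1; 1, 1, -1, 1; 1, -1, 1, 1; -1, 1, 1, 1]
  val_inv := by
    ext i j; fin_cases i <;> fin_cases j <;> simp [mul_apply, Fin.sum_univ_four] <;> norm_num
  inv_val := by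
    ext i j; fin_cases i <;> fin_cases j <;> simp [mul_apply, Fin.sum_univ_four] <;> norm_num

lemma wT_mul_self : wT * wT = 1 := Units.ext wT.val_inv

lemma wS_mul_self : wS * wS = 1 := Units.ext wS.val_inv

lemma wT_val : (wT : Matrix (Fin 4) (Fin 4) ℂ) = reflectionMatrix (Pi.single 3 1) := by
  ext i j
  fin_cases i <;> fin_cases j <;> simp [wT, reflectionMatrix, vecMulVec_apply] <;> norm_num

lemma wS_val : (wS : Matrix (Fin 4) (Fin 4) ℂ) = reflectionMatrix ![1/2, -1/2, -1/2, 1/2] := by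
  ext i j
  fin_cases i <;> fin_cases j <;>
    simp [wS, reflectionMatrix, vecMulVec_apply, dotProduct, Fin.sum_univ_four] <;> norm_num

lemma wT_mem : wT ∈ WF4 :=
  Subgroup.subset_closure ⟨_, Or.inl (Or.inr ⟨3, Or.inl rfl⟩), wT_val⟩

lemma wS_mem : wS ∈ WF4 :=
  Subgroup.subset_closure ⟨_, Or.inr (by intro i; fin_cases i <;> simp), wS_val⟩

lemma WD4_le_WF4 : WD4 ≤ WF4 :=
  Subgroup.closure_mono fun _ ⟨v, hv, h⟩ => ⟨v, Or.inl (Or.inl hv), h⟩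

/-- Conjugating a reflection by an orthogonal matrix. -/
lemma conj_reflectionMatrix (g : GL (Fin 4) ℂ)
    (hg : ((g⁻¹ : GL (Fin 4) ℂ) : Matrix (Fin 4) (Fin 4) ℂ) = (g : Matrix (Fin 4) (Fin 4) ℂ)ᵀ)
    (v : Fin 4 → ℂ) :
    (g : Matrix (Fin 4) (Fin 4) ℂ) * reflectionMatrix v *
      ((g⁻¹ : GL (Fin 4) ℂ) : Matrix (Fin 4) (Fin 4) ℂ) =
      reflectionMatrix ((g : Matrix (Fin 4) (Fin 4) ℂ) *ᵥ v) := by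
  have h1 : ((g : Matrix (Fin 4) (Fin 4) ℂ) *ᵥ v) ⬝ᵥ ((g : Matrix (Fin 4) (Fin 4) ℂ) *ᵥ v)
      = v ⬝ᵥ v := by
    rw [dotProduct_mulVec, vecMul_mulVec, ← hg]
    simp
  have h2 : (g : Matrix (Fin 4) (Fin 4) ℂ) * ((g⁻¹ : GL (Fin 4) ℂ) : Matrix (Fin 4) (Fin 4) ℂ) = 1 :=
    g.val_inv
  unfold reflectionMatrix
  rw [h1, mul_sub, sub_mul, mul_one, h2, mul_smul_comm, smul_mul_assoc, mul_vecMulVec,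
    vecMulVec_mul, hg, vecMul_transpose]

lemma wT_inv : wT⁻¹ = wT := by rw [inv_eq_iff_mul_eq_one, wT_mul_self]

lemma wS_inv : wS⁻¹ = wS := by rw [inv_eq_iff_mul_eq_one, wS_mul_self]

lemma wT_orth : ((wT⁻¹ : GL (Fin 4) ℂ) : Matrix (Fin 4) (Fin 4) ℂ) =
    (wT : Matrix (Fin 4) (Fin 4) ℂ)ᵀ := by
  rw [wT_inv]; ext i j; fin_cases i <;> fin_cases j <;> simp [wT]

lemma wS_orth : ((wS⁻¹ : GL (Fin 4) ℂ) : Matrix (Fin 4) (Fin 4) ℂ) =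
    (wS : Matrix (Fin 4) (Fin 4) ℂ)ᵀ := by
  rw [wS_inv]; ext i j; fin_cases i <;> fin_cases j <;> simp [wS]

lemma wT_mulVec_mem {v : Fin 4 → ℂ} (hv : v ∈ rootsD4) :
    (wT : Matrix (Fin 4) (Fin 4) ℂ) *ᵥ v ∈ rootsD4 := by
  obtain ⟨h, h2⟩ := hv
  choose n hn using h
  simp only [dotProduct, Fin.sum_univ_four] at h2
  refine ⟨fun i => ?_, ?_⟩
  · fin_cases i
    · exact ⟨n 0, by simp [wT, mulVec, dotProduct, Fin.sum_univ_four, hn]⟩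
    · exact ⟨n 1, by simp [wT, mulVec, dotProduct, Fin.sum_univ_four, hn]⟩
    · exact ⟨n 2, by simp [wT, mulVec, dotProduct, Fin.sum_univ_four, hn]⟩
    · exact ⟨-n 3, by simp [wT, mulVec, dotProduct, Fin.sum_univ_four, hn]⟩
  · simp [wT, mulVec, dotProduct, Fin.sum_univ_four]
    linear_combination h2

lemma wS_mulVec_mem {v : Fin 4 → ℂ} (hv : v ∈ rootsD4) :
    (wS : Matrix (Fin 4) (Fin 4) ℂ) *ᵥ v ∈ rootsD4 := by
  obtain ⟨h, h2⟩ := hv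
  choose n hn using h
  simp only [dotProduct, Fin.sum_univ_four] at h2
  have h3 : n 0 * n 0 + n 1 * n 1 + n 2 * n 2 + n 3 * n 3 = 2 := by
    simp only [hn] at h2; exact_mod_cast h2
  obtain ⟨k, hk⟩ : ∃ k, n 0 + n 1 + n 2 + n 3 = 2 * k := by
    have : Even (n 0 * n 0 + n 1 * n 1 + n 2 * n 2 + n 3 * n 3) := by rw [h3]; decide
    obtain ⟨k, hk⟩ : Even (n 0 + n 1 + n 2 + n 3) := by
      simpa [Int.even_add, Int.even_mul] using this
    exact ⟨k, by omega⟩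
  have hk' : (n 0 + n 1 + n 2 + n 3 : ℂ) = 2 * k := by exact_mod_cast hk
  refine ⟨fun i => ?_, ?_⟩
  · fin_cases i
    · exact ⟨k - n 3, by
        simp [wS, mulVec, dotProduct, Fin.sum_univ_four, hn]; linear_combination hk' / 2⟩
    · exact ⟨k - n 2, by
        simp [wS, mulVec, dotProduct, Fin.sum_univ_four, hn]; linear_combination hk' / 2⟩
    · exact ⟨k - n 1, by
        simp [wS, mulVec, dotProduct, Fin.sum_univ_four, hn]; linear_combination hk' / 2⟩
    · exact ⟨k - n 0, by
        simp [wS, mulVec, dotProduct, Fin.sum_univ_four, hn]; linear_combination hk' / 2⟩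
  · simp [wS, mulVec, dotProduct, Fin.sum_univ_four]
    linear_combination h2

lemma mem_normalizer {g : GL (Fin 4) ℂ} (hgg : g * g = 1)
    (hg : ((g⁻¹ : GL (Fin 4) ℂ) : Matrix (Fin 4) (Fin 4) ℂ) = (g : Matrix (Fin 4) (Fin 4) ℂ)ᵀ)
    (h : ∀ v ∈ rootsD4, (g : Matrix (Fin 4) (Fin 4) ℂ) *ᵥ v ∈ rootsD4) :
    g ∈ Subgroup.normalizer (WD4 : Set (GL (Fin 4) ℂ)) := by
  have key : ∀ x ∈ WD4, g * x * g⁻¹ ∈ WD4 := by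
    intro x hx
    have : WD4 ≤ WD4.comap (MulAut.conj g).toMonoidHom := by
      refine (Subgroup.closure_le _).2 ?_
      rintro y ⟨v, hv, hy⟩
      refine Subgroup.subset_closure ⟨_, h v hv, ?_⟩
      simpa [hy] using conj_reflectionMatrix g hg v
    simpa using this hx
  rw [Subgroup.mem_normalizer_iff]
  refine fun x => ⟨key x, fun hx => ?_⟩
  have hi : g⁻¹ = g := by rw [inv_eq_iff_mul_eq_one, hgg]
  have := key _ hx
  rw [hi] at this
  simpa [← mul_assoc, hgg, mul_assoc _ g g] using this

/-- The group generated by `W(D₄)`, `wS` and `wT`. -/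
def auxGroup : Subgroup (GL (Fin 4) ℂ) := WD4 ⊔ Subgroup.closure {wS, wT}

lemma wS_mem_aux : wS ∈ auxGroup :=
  (le_sup_right : _ ≤ auxGroup) (Subgroup.subset_closure (by simp))

lemma wT_mem_aux : wT ∈ auxGroup :=
  (le_sup_right : _ ≤ auxGroup) (Subgroup.subset_closure (by simp))

lemma aux_le_normalizer : auxGroup ≤ Subgroup.normalizer (WD4 : Set (GL (Fin 4) ℂ)) := by
  refine sup_le Subgroup.le_normalizer ((Subgroup.closure_le _).2 ?_)
  rintro x (rfl | rfl)
  · exact mem_normalizer wS_mul_self wS_orth fun v => wS_mulVec_mem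
  · exact mem_normalizer wT_mul_self wT_orth fun v => wT_mulVec_mem

/-- A diagonal matrix of signs. -/
def signGL (d : Fin 4 → ℤˣ) : GL (Fin 4) ℂ where
  val := diagonal fun i => ((d i : ℤ) : ℂ)
  inv := diagonal fun i => ((d i : ℤ) : ℂ)
  val_inv := by
    rw [diagonal_mul_diagonal, ← diagonal_one]; congr 1; ext i
    rw [← Int.cast_mul, ← Units.val_mul, Int.units_mul_self]; simp
  inv_val := by
    rw [diagonal_mul_diagonal, ← diagonal_one]; congr 1; ext i
    rw [← Int.cast_mul, ← Units.val_mul, Int.units_mul_self]; simp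

lemma reflectionMatrix_mul_self {v : Fin 4 → ℂ} (hv : v ⬝ᵥ v ≠ 0) :
    reflectionMatrix v * reflectionMatrix v = 1 := by
  unfold reflectionMatrix
  rw [sub_mul, one_mul, mul_sub, mul_one, smul_mul_smul_comm, vecMulVec_mul_vecMulVec,
    vecMulVec_smul, smul_smul]
  have : 2 / (v ⬝ᵥ v) * (2 / (v ⬝ᵥ v)) * (v ⬝ᵥ v) = 2 / (v ⬝ᵥ v) + 2 / (v ⬝ᵥ v) := by
    field_simp; norm_num
  rw [this, add_smul]
  abel

/-- A reflection as an invertible matrix. -/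
def reflectionGL (v : Fin 4 → ℂ) (hv : v ⬝ᵥ v ≠ 0) : GL (Fin 4) ℂ :=
  ⟨reflectionMatrix v, reflectionMatrix v, reflectionMatrix_mul_self hv,
    reflectionMatrix_mul_self hv⟩

lemma reflectionGL_orth (v : Fin 4 → ℂ) (hv : v ⬝ᵥ v ≠ 0) :
    (((reflectionGL v hv)⁻¹ : GL (Fin 4) ℂ) : Matrix (Fin 4) (Fin 4) ℂ) =
      (reflectionGL v hv : Matrix (Fin 4) (Fin 4) ℂ)ᵀ := by
  change reflectionMatrix v = (reflectionMatrix v)ᵀ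
  ext i j
  simp [reflectionMatrix, vecMulVec_apply, one_apply, eq_comm, mul_comm (v i)]

lemma flip_mem_aux (i : Fin 4) {g : GL (Fin 4) ℂ}
    (hg : (g : Matrix (Fin 4) (Fin 4) ℂ) = reflectionMatrix (Pi.single i 1)) : g ∈ auxGroup := by
  by_cases hi : i = 3
  · subst hi
    rw [show g = wT from Units.ext (hg.trans wT_val.symm)]
    exact wT_mem_aux
  have hr : (Pi.single i 1 - Pi.single 3 1 : Fin 4 → ℂ) ∈ rootsD4 := by
    refine ⟨fun j => ⟨(Pi.single i 1 - Pi.single 3 1 : Fin 4 → ℤ) j, ?_⟩, ?_⟩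
    · simp [Pi.single_apply]
    · simp [hi, Ne.symm hi]; norm_num
  have h0 : (Pi.single i 1 - Pi.single 3 1 : Fin 4 → ℂ) ⬝ᵥ (Pi.single i 1 - Pi.single 3 1) ≠ 0 := by
    rw [hr.2]; norm_num
  have hrm : reflectionGL _ h0 ∈ auxGroup :=
    (le_sup_left : _ ≤ auxGroup) (Subgroup.subset_closure ⟨_, hr, rfl⟩)
  have : g = reflectionGL _ h0 * wT * (reflectionGL _ h0)⁻¹ := by
    apply Units.ext
    rw [Units.val_mul, Units.val_mul, wT_val, conj_reflectionMatrix _ (reflectionGL_orth _ h0), hg]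
    congr 1
    change _ = reflectionMatrix _ *ᵥ _
    rw [reflectionMatrix, hr.2, sub_mulVec, one_mulVec, div_self two_ne_zero, one_smul,
      vecMulVec_mulVec]
    ext j
    simp [hi]
  rw [this]
  exact mul_mem (mul_mem hrm wT_mem_aux) (inv_mem hrm)

lemma signGL_mem_aux (d : Fin 4 → ℤˣ) : signGL d ∈ auxGroup := by
  have h (i : Fin 4) (e : ℤˣ) : signGL (Pi.mulSingle i e) ∈ auxGroup := by
    rcases Int.units_eq_one_or e with rfl | rfl
    · have : signGL (Pi.mulSingle i 1) = 1 := by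
        apply Units.ext; simp [signGL]
      rw [this]; exact one_mem _
    · apply flip_mem_aux i
      ext a b
      fin_cases i <;> fin_cases a <;> fin_cases b <;>
        simp [signGL, reflectionMatrix, vecMulVec_apply, Pi.mulSingle_apply] <;> norm_num
  have : signGL d = signGL (Pi.mulSingle 0 (d 0)) * signGL (Pi.mulSingle 1 (d 1)) *
      signGL (Pi.mulSingle 2 (d 2)) * signGL (Pi.mulSingle 3 (d 3)) := by
    apply Units.ext
    ext a b
    simp only [signGL, Units.val_mul, diagonal_mul_diagonal]
    fin_cases a <;> fin_cases b <;> simp [Pi.mulSingle_apply]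
  rw [this]
  exact mul_mem (mul_mem (mul_mem (h _ _) (h _ _)) (h _ _)) (h _ _)

lemma reflectionMatrix_neg (v : Fin 4 → ℂ) : reflectionMatrix (-v) = reflectionMatrix v := by
  simp [reflectionMatrix]

lemma half_mem_aux {v : Fin 4 → ℂ} (hv : ∀ i, v i = 1 / 2 ∨ v i = -1 / 2) {g : GL (Fin 4) ℂ}
    (hg : (g : Matrix (Fin 4) (Fin 4) ℂ) = reflectionMatrix v) : g ∈ auxGroup := by
  have hc (i : Fin 4) : ∃ c : ℤˣ, v i = (c : ℤ) / 2 := by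
    rcases hv i with h | h
    · exact ⟨1, by simp [h]⟩
    · exact ⟨-1, by simp [h]⟩
  choose c hc using hc
  let d : Fin 4 → ℤˣ := ![c 0, -c 1, -c 2, c 3]
  have ho : (((signGL d)⁻¹ : GL (Fin 4) ℂ) : Matrix (Fin 4) (Fin 4) ℂ) =
      (signGL d : Matrix (Fin 4) (Fin 4) ℂ)ᵀ := by
    change diagonal _ = (diagonal _)ᵀ
    rw [diagonal_transpose]
  have : g = signGL d * wS * (signGL d)⁻¹ := by
    apply Units.ext
    rw [Units.val_mul, Units.val_mul, wS_val, conj_reflectionMatrix _ ho, hg]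
    congr 1
    ext i
    change _ = (diagonal _ *ᵥ _) i
    rw [mulVec_diagonal, hc]
    fin_cases i <;> simp [d] <;> ring
  rw [this]
  exact mul_mem (mul_mem (signGL_mem_aux d) wS_mem_aux) (inv_mem (signGL_mem_aux d))

lemma WF4_eq_aux : WF4 = auxGroup := by
  apply le_antisymm
  · refine (Subgroup.closure_le _).2 ?_
    rintro g ⟨v, (hv | ⟨i, rfl | rfl⟩) | hv, hg⟩
    · exact (le_sup_left : _ ≤ auxGroup) (Subgroup.subset_closure ⟨v, hv, hg⟩)
    · exact flip_mem_aux i hg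
    · exact flip_mem_aux i (by rw [hg, reflectionMatrix_neg])
    · exact half_mem_aux hv hg
  · refine sup_le WD4_le_WF4 ((Subgroup.closure_le _).2 ?_)
    rintro x (rfl | rfl)
    exacts [wS_mem, wT_mem]

instance WD4_normal : (WD4.subgroupOf WF4).Normal := by
  apply Subgroup.normal_subgroupOf_of_le_normalizer
  rw [WF4_eq_aux]
  exact aux_le_normalizer

/-- The quotient `W(F₄) / W(D₄)`. -/
abbrev F4ModD4 : Type := WF4 ⧸ WD4.subgroupOf WF4

/-- The quotient map `W(F₄) → W(F₄) / W(D₄)`. -/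
def phi2 : WF4 →* F4ModD4 := QuotientGroup.mk' (WD4.subgroupOf WF4)

instance Gamma_two_normal : (Gamma 2).Normal := Gamma_normal 2

/-- The quotient `SL₂(ℤ) / Γ(2)`. -/
abbrev SL2ModGamma2 : Type := SL(2, ℤ) ⧸ Gamma 2

/-- The quotient map `SL₂(ℤ) → SL₂(ℤ) / Γ(2)`. -/
def phi1 : SL(2, ℤ) →* SL2ModGamma2 := QuotientGroup.mk' (Gamma 2)

/-- `wS` as an element of `W(F₄)`. -/
def sF4 : WF4 := ⟨wS, wS_mem⟩

/-- `wT` as an element of `W(F₄)`. -/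
def tF4 : WF4 := ⟨wT, wT_mem⟩

lemma closure_phi2 : Subgroup.closure {phi2 sF4, phi2 tF4} = ⊤ := by
  rw [eq_top_iff]
  rintro x -
  obtain ⟨⟨g, hg⟩, rfl⟩ := QuotientGroup.mk'_surjective _ x
  have hle : WF4 ≤ ((Subgroup.closure {phi2 sF4, phi2 tF4}).comap phi2).map WF4.subtype := by
    conv_lhs => rw [WF4_eq_aux]
    refine sup_le ?_ ((Subgroup.closure_le _).2 ?_)
    · intro y hy
      refine ⟨⟨y, WD4_le_WF4 hy⟩, ?_, rfl⟩
      have : phi2 ⟨y, WD4_le_WF4 hy⟩ = 1 :=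
        (QuotientGroup.eq_one_iff _).2 (Subgroup.mem_subgroupOf.2 hy)
      simp [this, one_mem]
    · rintro y (rfl | rfl)
      · exact ⟨sF4, Subgroup.subset_closure (by simp), rfl⟩
      · exact ⟨tF4, Subgroup.subset_closure (by simp), rfl⟩
  obtain ⟨y, hy, hyg⟩ := hle hg
  have : y = ⟨g, hg⟩ := Subtype.ext hyg
  subst this
  exact hy

lemma WD4_integral {g : GL (Fin 4) ℂ} (hg : g ∈ WD4) (i j : Fin 4) :
    ∃ n : ℤ, (g : Matrix (Fin 4) (Fin 4) ℂ) i j = n := by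
  have hgen : ∀ g : GL (Fin 4) ℂ, (∃ v ∈ rootsD4, (g : Matrix (Fin 4) (Fin 4) ℂ) =
      reflectionMatrix v) → g⁻¹ = g ∧ ∀ i j, ∃ n : ℤ, (g : Matrix (Fin 4) (Fin 4) ℂ) i j = n := by
    rintro g ⟨v, hv, h⟩
    refine ⟨?_, fun i j => ?_⟩
    · rw [inv_eq_iff_mul_eq_one]
      apply Units.ext
      rw [Units.val_mul, h]
      exact reflectionMatrix_mul_self (by rw [hv.2]; norm_num)
    · obtain ⟨a, ha⟩ := hv.1 i
      obtain ⟨b, hb⟩ := hv.1 j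
      refine ⟨(1 : Matrix (Fin 4) (Fin 4) ℤ) i j - a * b, ?_⟩
      rw [h, reflectionMatrix, hv.2]
      simp [vecMulVec_apply, ha, hb, one_apply]
  have hmul : ∀ x y : GL (Fin 4) ℂ, (∀ i j, ∃ n : ℤ, (x : Matrix (Fin 4) (Fin 4) ℂ) i j = n) →
      (∀ i j, ∃ n : ℤ, (y : Matrix (Fin 4) (Fin 4) ℂ) i j = n) →
      ∀ i j, ∃ n : ℤ, ((x * y : GL (Fin 4) ℂ) : Matrix (Fin 4) (Fin 4) ℂ) i j = n := by
    intro x y hx hy i j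
    choose a ha using hx
    choose b hb using hy
    exact ⟨∑ k, a i k * b k j, by simp [mul_apply, ha, hb]⟩
  revert i j
  refine Subgroup.closure_induction'' (p := fun (g : GL (Fin 4) ℂ) _ => ∀ i j, ∃ n : ℤ,
    (g : Matrix (Fin 4) (Fin 4) ℂ) i j = n) ?_ ?_ ?_ ?_ hg
  · exact fun x hx => (hgen x hx).2
  · intro x hx; rw [(hgen x hx).1]; exact (hgen x hx).2
  · intro i j; exact ⟨(1 : Matrix (Fin 4) (Fin 4) ℤ) i j, by simp [one_apply]⟩
  · exact fun x y _ _ hx hy => hmul x y hx hy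

lemma half_not_int (n : ℤ) : (1 / 2 : ℂ) ≠ n := by
  intro h
  have : (1 : ℂ) = ((2 * n : ℤ) : ℂ) := by push_cast; linear_combination 2 * h
  have : (1 : ℤ) = 2 * n := by exact_mod_cast this
  omega

lemma phi2_sF4_ne : phi2 sF4 ≠ 1 := by
  intro h
  obtain ⟨n, hn⟩ := WD4_integral (Subgroup.mem_subgroupOf.1 ((QuotientGroup.eq_one_iff _).1 h)) 0 0
  exact half_not_int n (by rw [← hn]; simp [sF4, wS])

lemma phi2_mul_ne : phi2 sF4 * phi2 tF4 ≠ 1 := by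
  rw [← map_mul]
  intro h
  obtain ⟨n, hn⟩ := WD4_integral (Subgroup.mem_subgroupOf.1 ((QuotientGroup.eq_one_iff _).1 h)) 0 0
  exact half_not_int n (by
    rw [← hn]; simp [sF4, tF4, wS, wT, vecMul, dotProduct, Fin.sum_univ_four])

lemma phi2_sF4_sq : phi2 sF4 * phi2 sF4 = 1 := by
  rw [← map_mul, show sF4 * sF4 = 1 from Subtype.ext wS_mul_self, map_one]

lemma phi2_tF4_sq : phi2 tF4 * phi2 tF4 = 1 := by
  rw [← map_mul, show tF4 * tF4 = 1 from Subtype.ext wT_mul_self, map_one]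

lemma phi2_braid : phi2 sF4 * phi2 tF4 * phi2 sF4 = phi2 tF4 * phi2 sF4 * phi2 tF4 := by
  simp only [← map_mul]
  refine congrArg phi2 (Subtype.ext (Units.ext ?_))
  simp only [sF4, tF4, Subgroup.coe_mul, Units.val_mul]
  ext i j
  fin_cases i <;> fin_cases j <;>
    simp [wS, wT, mul_apply, Fin.sum_univ_four] <;> norm_num

/-- The six words `1, a, b, ab, ba, aba`. -/
def word {G : Type*} [Group G] (a b : G) : Fin 6 → G := ![1, a, b, a * b, b * a, a * b * a]

/-- The multiplication table of the words. -/
def wordTable : Fin 6 → Fin 6 → Fin 6 :=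
  ![![0, 1, 2, 3, 4, 5], ![1, 0, 3, 2, 5, 4], ![2, 4, 0, 5, 1, 3],
    ![3, 5, 1, 4, 0, 2], ![4, 2, 5, 0, 3, 1], ![5, 3, 4, 1, 2, 0]]

lemma word_mul {G : Type*} [Group G] {a b : G} (ha : a * a = 1) (hb : b * b = 1)
    (hab : a * b * a = b * a * b) (i j : Fin 6) :
    word a b i * word a b j = word a b (wordTable i j) := by
  have ha' (x : G) : a * (a * x) = x := by rw [← mul_assoc, ha, one_mul]
  have hb' (x : G) : b * (b * x) = x := by rw [← mul_assoc, hb, one_mul]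
  have h1 : b * (a * b) = a * (b * a) := by rw [← mul_assoc, ← hab, mul_assoc]
  have h2 (x : G) : b * (a * (b * x)) = a * (b * (a * x)) := by
    simpa [mul_assoc] using congrArg (· * x) h1
  fin_cases i <;> fin_cases j <;> simp [word, wordTable, mul_assoc, ha, hb, ha', hb', h1, h2]

/-- The reduction of `S` modulo `2`. -/
def sMod : SL(2, ZMod 2) := ⟨!![0, 1; 1, 0], by decide⟩

/-- The reduction of `T` modulo `2`. -/
def tMod : SL(2, ZMod 2) := ⟨!![1, 1; 0, 1], by decide⟩

lemma word_bijective : Function.Bijective (word sMod tMod) := by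
  constructor
  · decide
  · rintro ⟨m, hm⟩
    have : ∀ m : Matrix (Fin 2) (Fin 2) (ZMod 2), m.det = 1 →
      ∃ i, ((word sMod tMod i : SL(2, ZMod 2)) : Matrix (Fin 2) (Fin 2) (ZMod 2)) = m := by decide
    obtain ⟨i, hi⟩ := this m hm
    exact ⟨i, Subtype.ext hi⟩

/-- The homomorphism `SL₂(ℤ/2) → W(F₄) / W(D₄)` that carries `S` to `wS` and `T` to `wT`. -/
def modTwoHom : SL(2, ZMod 2) →* F4ModD4 where
  toFun x := word (phi2 sF4) (phi2 tF4) ((Equiv.ofBijective _ word_bijective).symm x)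
  map_one' := by
    have : (Equiv.ofBijective _ word_bijective).symm (1 : SL(2, ZMod 2)) = 0 := by
      rw [Equiv.symm_apply_eq]; rfl
    rw [this]; rfl
  map_mul' x y := by
    obtain ⟨i, rfl⟩ := (Equiv.ofBijective _ word_bijective).surjective x
    obtain ⟨j, rfl⟩ := (Equiv.ofBijective _ word_bijective).surjective y
    have h : Equiv.ofBijective _ word_bijective i * Equiv.ofBijective _ word_bijective j =
        Equiv.ofBijective _ word_bijective (wordTable i j) :=
      word_mul (by decide) (by decide) (by decide) i j
    rw [h]
    simp only [Equiv.symm_apply_apply]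
    rw [word_mul phi2_sF4_sq phi2_tF4_sq phi2_braid]

lemma modTwoHom_word (i : Fin 6) :
    modTwoHom (word sMod tMod i) = word (phi2 sF4) (phi2 tF4) i := by
  change word _ _ ((Equiv.ofBijective _ word_bijective).symm (word sMod tMod i)) = _
  rw [Equiv.ofBijective_symm_apply_apply]

lemma modTwoHom_injective : Function.Injective modTwoHom := by
  rw [injective_iff_map_eq_one]
  intro x
  obtain ⟨i, rfl⟩ := word_bijective.2 x
  rw [modTwoHom_word]
  have hb : phi2 tF4 ≠ 1 := by
    intro h
    have := phi2_braid
    rw [h, mul_one, mul_one, one_mul, phi2_sF4_sq] at this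
    exact phi2_sF4_ne this.symm
  have hs : (phi2 sF4)⁻¹ = phi2 sF4 := by rw [inv_eq_iff_mul_eq_one, phi2_sF4_sq]
  fin_cases i
  · simp [word]
  · intro h; exact absurd h phi2_sF4_ne
  · intro h; exact absurd h hb
  · intro h; exact absurd h phi2_mul_ne
  · intro h
    exact absurd (mul_eq_one_comm.1 h) phi2_mul_ne
  · intro h
    refine absurd ?_ hb
    change phi2 sF4 * phi2 tF4 * phi2 sF4 = 1 at h
    rw [mul_eq_one_iff_eq_inv, hs] at h
    simpa using h

/-- The homomorphism `SL₂(ℤ) / Γ(2) → W(F₄) / W(D₄)` with `S ↦ wS` and `T ↦ wT`. -/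
def trialityHom : SL2ModGamma2 →* F4ModD4 :=
  QuotientGroup.lift (Gamma 2)
    (modTwoHom.comp (SpecialLinearGroup.map (Int.castRingHom (ZMod 2)))) (by
      intro g hg
      rw [MonoidHom.mem_ker, MonoidHom.comp_apply, show SpecialLinearGroup.map (Int.castRingHom (ZMod 2)) g = 1 from
        Gamma_mem'.1 hg, map_one])

lemma trialityHom_S : trialityHom (phi1 ModularGroup.S) = phi2 sF4 := by
  have : SpecialLinearGroup.map (Int.castRingHom (ZMod 2)) ModularGroup.S = word sMod tMod 1 := by
    decide
  change modTwoHom _ = _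
  rw [this, modTwoHom_word]
  rfl

lemma trialityHom_T : trialityHom (phi1 ModularGroup.T) = phi2 tF4 := by
  have : SpecialLinearGroup.map (Int.castRingHom (ZMod 2)) ModularGroup.T = word sMod tMod 2 := by
    decide
  change modTwoHom _ = _
  rw [this, modTwoHom_word]
  rfl

lemma trialityHom_bijective : Function.Bijective trialityHom := by
  constructor
  · rw [injective_iff_map_eq_one]
    intro x hx
    obtain ⟨g, rfl⟩ := QuotientGroup.mk'_surjective _ x
    refine (QuotientGroup.eq_one_iff _).2 (Gamma_mem'.2 ?_)
    exact modTwoHom_injective (hx.trans (map_one _).symm)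
  · rw [← MonoidHom.range_eq_top, eq_top_iff, ← closure_phi2, Subgroup.closure_le]
    rintro x (rfl | rfl)
    exacts [⟨_, trialityHom_S⟩, ⟨_, trialityHom_T⟩]

/-- The identification `SL₂(ℤ) / Γ(2) ≅ W(F₄) / W(D₄)` of the two copies of `S₃`, under which the
class of `S` corresponds to that of `wS` and the class of `T` to that of `wT`. -/
def trialityIso : SL2ModGamma2 ≃* F4ModD4 :=
  MulEquiv.ofBijective trialityHom trialityHom_bijective

lemma trialityIso_S : trialityIso (phi1 ModularGroup.S) = phi2 sF4 := trialityHom_S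

lemma trialityIso_T : trialityIso (phi1 ModularGroup.T) = phi2 tF4 := trialityHom_T

/-- The fibre product `SL₂(ℤ) ×_{S₃} W(F₄)`. -/
def trialityGroup : Subgroup (SL(2, ℤ) × WF4) :=
  ((trialityIso.toMonoidHom.comp phi1).comp (MonoidHom.fst _ _)).eqLocus
    (phi2.comp (MonoidHom.snd _ _))

lemma mem_trialityGroup {x : SL(2, ℤ) × WF4} :
    x ∈ trialityGroup ↔ trialityIso (phi1 x.1) = phi2 x.2 := Iff.rfl

/-- The action of `W(F₄)` on `ℂ⁴`. -/
def act (w : WF4) (z : Fin 4 → ℂ) : Fin 4 → ℂ :=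
  ((w : GL (Fin 4) ℂ) : Matrix (Fin 4) (Fin 4) ℂ) *ᵥ z

/-- A `D₄` triality invariant of weight `k` and degree `m`. -/
structure IsTrialityInvariant (k : ℤ) (m : ℕ) (φ : ℍ → (Fin 4 → ℂ) → ℂ) : Prop where
  /-- `φ` is holomorphic on `ℍ × ℂ⁴`. -/
  holo : DifferentiableOn ℂ (fun p : ℂ × (Fin 4 → ℂ) => φ (ofComplex p.1) p.2) {p | 0 < p.1.im}
  /-- `φ` is a homogeneous polynomial of degree `m` in `z`. -/
  poly : ∀ τ, ∃ P : MvPolynomial (Fin 4) ℂ, P.IsHomogeneous m ∧ ∀ z, φ τ z = MvPolynomial.eval z P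
  /-- The transformation law: `φ ((aτ + b) / (cτ + d), w z) = (cτ + d) ^ k φ (τ, z)`. -/
  transform : ∀ x ∈ trialityGroup, ∀ τ z, φ (x.1 • τ) (act x.2 z) = denom x.1 τ ^ k * φ τ z
  /-- The cusp condition: `|φ (τ, z₁, z₂, z₃, q ^ (-1/2) Λ)|`, where `q ^ (1/2) = exp (π i τ)`, has
  a finite limit for `Im τ → ∞`. -/
  cusp : ∀ z₁ z₂ z₃ Λ : ℂ, Λ ≠ 0 → ∃ l : ℝ, Tendsto (fun τ : ℍ =>
    ‖φ τ ![z₁, z₂, z₃, Complex.exp (-(Real.pi * Complex.I * τ)) * Λ]‖) atImInfty (𝓝 l)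

lemma tendsto_of_bounded {k : ℤ} {φ : ℍ → (Fin 4 → ℂ) → ℂ}
    (holo : DifferentiableOn ℂ (fun p : ℂ × (Fin 4 → ℂ) => φ (ofComplex p.1) p.2) {p | 0 < p.1.im})
    (transform : ∀ x ∈ trialityGroup, ∀ τ z, φ (x.1 • τ) (act x.2 z) = denom x.1 τ ^ k * φ τ z)
    (z₁ z₂ z₃ Λ : ℂ) (hb : IsBoundedAtImInfty fun τ : ℍ =>
      φ τ ![z₁, z₂, z₃, Complex.exp (-(Real.pi * Complex.I * τ)) * Λ]) :
    ∃ l : ℝ, Tendsto (fun τ : ℍ =>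
      ‖φ τ ![z₁, z₂, z₃, Complex.exp (-(Real.pi * Complex.I * τ)) * Λ]‖) atImInfty (𝓝 l) := by
  have hT : (ModularGroup.T ^ 2, (1 : WF4)) ∈ trialityGroup := by
    rw [mem_trialityGroup]
    have : phi1 (ModularGroup.T ^ 2) = 1 :=
      (QuotientGroup.eq_one_iff _).2 (Gamma_mem'.2 (by decide))
    rw [this, map_one, map_one]
  have hT' (τ τ' : ℍ) (h : (τ' : ℂ) = τ + 2) (z : Fin 4 → ℂ) : φ τ' z = φ τ z := by
    have h1 := transform _ hT τ z
    have h2 : (ModularGroup.T ^ 2) • τ = τ' := by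
      apply UpperHalfPlane.ext
      rw [h]
      simpa using! _root_.ModularGroup.coe_T_zpow_smul_eq (n := 2) (z := τ)
    have h3 : denom (ModularGroup.T ^ 2 : SL(2, ℤ)) τ = 1 := by
      have := ModularGroup.coe_T_zpow 2
      have e : (ModularGroup.T ^ 2 : SL(2, ℤ)) = ModularGroup.T ^ (2 : ℤ) := rfl
      rw [e, ModularGroup.denom_apply, this]; simp
    rw [h2, h3, _root_.one_zpow, one_mul] at h1
    simpa [act] using h1
  let F : ℂ → ℂ := fun t =>
    φ (ofComplex t) ![z₁, z₂, z₃, Complex.exp (-(Real.pi * Complex.I * t)) * Λ]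
  have hper : Function.Periodic F (2 : ℝ) := by
    intro t
    have he : Complex.exp (-(Real.pi * Complex.I * (t + (2 : ℝ)))) =
        Complex.exp (-(Real.pi * Complex.I * t)) := by
      rw [Complex.exp_eq_exp_iff_exists_int]
      exact ⟨-1, by push_cast; ring⟩
    simp only [F, he]
    by_cases ht : 0 < t.im
    · have ht' : 0 < (t + (2 : ℝ)).im := by simpa using ht
      apply hT'
      rw [ofComplex_apply_of_im_pos ht, ofComplex_apply_of_im_pos ht']
      simp
    · rw [ofComplex_apply_of_im_nonpos (not_lt.1 ht), ofComplex_apply_of_im_nonpos]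
      simpa using ht
  have hdiff : ∀ t : ℂ, 0 < t.im → DifferentiableAt ℂ F t := by
    intro t ht
    have ho : IsOpen {p : ℂ × (Fin 4 → ℂ) | 0 < p.1.im} :=
      isOpen_lt continuous_const (Complex.continuous_im.comp continuous_fst)
    have h1 := (holo _ (show (t, ![z₁, z₂, z₃, Complex.exp (-(Real.pi * Complex.I * t)) * Λ]) ∈
      {p : ℂ × (Fin 4 → ℂ) | 0 < p.1.im} from ht)).differentiableAt (ho.mem_nhds ht)
    have h2 : DifferentiableAt ℂ (fun t : ℂ =>
        (t, ![z₁, z₂, z₃, Complex.exp (-(Real.pi * Complex.I * t)) * Λ])) t := by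
      refine differentiableAt_id.prodMk (differentiableAt_pi.2 fun i => ?_)
      fin_cases i <;> simp <;> fun_prop
    exact h1.comp t h2
  have hev : ∀ᶠ t in comap Complex.im atTop, DifferentiableAt ℂ F t := by
    filter_upwards [preimage_mem_comap (Ioi_mem_atTop (0 : ℝ))] with t ht using hdiff t ht
  have hbd : BoundedAtFilter (comap Complex.im atTop) F := by
    have := hb.comp_tendsto tendsto_comap_im_ofComplex
    refine this.congr' ?_ EventuallyEq.rfl
    filter_upwards [preimage_mem_comap (Ioi_mem_atTop (0 : ℝ))] with t ht
    simp only [Function.comp, F]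
    rw [ofComplex_apply_of_im_pos ht]
  have hlim := Function.Periodic.tendsto_at_I_inf two_pos hper hev hbd
  have hlim' := (hlim.comp tendsto_coe_atImInfty).norm
  refine ⟨_, hlim'.congr fun τ => ?_⟩
  simp [F]

lemma IsTrialityInvariant.bounded {k : ℤ} {m : ℕ} {φ : ℍ → (Fin 4 → ℂ) → ℂ}
    (h : IsTrialityInvariant k m φ) (z₁ z₂ z₃ : ℂ) {Λ : ℂ} (hΛ : Λ ≠ 0) :
    IsBoundedAtImInfty fun τ : ℍ =>
      φ τ ![z₁, z₂, z₃, Complex.exp (-(Real.pi * Complex.I * τ)) * Λ] := by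
  obtain ⟨l, hl⟩ := h.cusp z₁ z₂ z₃ Λ hΛ
  exact (hl.isBigO_one ℝ).of_norm_left

/-- The space of `D₄` triality invariants of weight `k` and degree `m`. -/
def invariants (m : ℕ) (k : ℤ) : Submodule ℂ (ℍ → (Fin 4 → ℂ) → ℂ) where
  carrier := {φ | IsTrialityInvariant k m φ}
  zero_mem' :=
    { holo := differentiableOn_const 0
      poly := fun _ => ⟨0, MvPolynomial.isHomogeneous_zero _ _ _, by simp⟩
      transform := by simp
      cusp := fun _ _ _ _ _ => ⟨0, by simp⟩ }
  add_mem' {φ ψ} hφ hψ := by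
    have h1 : DifferentiableOn ℂ (fun p : ℂ × (Fin 4 → ℂ) => (φ + ψ) (ofComplex p.1) p.2)
        {p | 0 < p.1.im} := hφ.holo.add hψ.holo
    have h2 : ∀ x ∈ trialityGroup, ∀ τ z,
        (φ + ψ) (x.1 • τ) (act x.2 z) = denom x.1 τ ^ k * (φ + ψ) τ z := by
      intro x hx τ z
      simp only [Pi.add_apply, hφ.transform x hx, hψ.transform x hx, mul_add]
    refine ⟨h1, fun τ => ?_, h2, fun z₁ z₂ z₃ Λ hΛ => tendsto_of_bounded h1 h2 _ _ _ _
      ((hφ.bounded z₁ z₂ z₃ hΛ).add (hψ.bounded z₁ z₂ z₃ hΛ))⟩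
    obtain ⟨P, hP, hP'⟩ := hφ.poly τ
    obtain ⟨Q, hQ, hQ'⟩ := hψ.poly τ
    exact ⟨P + Q, hP.add hQ, fun z => by simp [hP', hQ']⟩
  smul_mem' c φ hφ :=
    { holo := hφ.holo.const_smul c
      poly := fun τ => by
        obtain ⟨P, hP, hP'⟩ := hφ.poly τ
        refine ⟨MvPolynomial.C c * P, ?_, fun z => by simp [hP']⟩
        simpa using (MvPolynomial.isHomogeneous_C _ c).mul hP
      transform := fun x hx τ z => by
        simp only [Pi.smul_apply, smul_eq_mul, hφ.transform x hx]; ring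
      cusp := fun z₁ z₂ z₃ Λ hΛ => by
        obtain ⟨l, hl⟩ := hφ.cusp z₁ z₂ z₃ Λ hΛ
        exact ⟨‖c‖ * l, by simpa [norm_mul] using hl.const_mul ‖c‖⟩ }

lemma modularForm_differentiableOn {i : ℤ} (f : ModularForm 𝒮ℒ i) :
    DifferentiableOn ℂ (fun p : ℂ × (Fin 4 → ℂ) => f (ofComplex p.1)) {p | 0 < p.1.im} := by
  have hf : DifferentiableOn ℂ (f ∘ ofComplex) {t : ℂ | 0 < t.im} :=
    UpperHalfPlane.mdifferentiable_iff.1 (ModularFormClass.holo f)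
  intro p hp
  have ho : IsOpen {t : ℂ | 0 < t.im} := isOpen_lt continuous_const Complex.continuous_im
  have h1 : DifferentiableAt ℂ (f ∘ ofComplex) p.1 := (hf p.1 hp).differentiableAt (ho.mem_nhds hp)
  exact (DifferentiableAt.comp p h1 differentiableAt_fst).differentiableWithinAt

lemma modularForm_transform {i : ℤ} (f : ModularForm 𝒮ℒ i) (g : SL(2, ℤ)) (τ : ℍ) :
    f (g • τ) = denom g τ ^ i * f τ := by
  have h : (g : GL (Fin 2) ℝ) ∈ 𝒮ℒ := MonoidHom.mem_range.2 ⟨g, rfl⟩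
  exact SlashInvariantForm.slash_action_eqn'' f h τ

lemma modularForm_bounded {i : ℤ} (f : ModularForm 𝒮ℒ i) : IsBoundedAtImInfty f :=
  ModularFormClass.bdd_at_infty f

lemma IsTrialityInvariant.modularForm_mul {i j : ℤ} {m : ℕ} (f : ModularForm 𝒮ℒ i)
    {φ : ℍ → (Fin 4 → ℂ) → ℂ} (hφ : IsTrialityInvariant j m φ) :
    IsTrialityInvariant (i + j) m (fun τ z => f τ * φ τ z) := by
  have h1 := (modularForm_differentiableOn f).mul hφ.holo
  have h2 : ∀ x ∈ trialityGroup, ∀ τ z,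
      f (x.1 • τ) * φ (x.1 • τ) (act x.2 z) = denom x.1 τ ^ (i + j) * (f τ * φ τ z) := by
    intro x hx τ z
    rw [modularForm_transform, hφ.transform x hx, zpow_add₀ (denom_ne_zero _ τ)]
    ring
  refine ⟨h1, fun τ => ?_, h2, fun z₁ z₂ z₃ Λ hΛ => tendsto_of_bounded
    (φ := fun τ z => f τ * φ τ z) h1 h2 _ _ _ _ ?_⟩
  · obtain ⟨P, hP, hP'⟩ := hφ.poly τ
    refine ⟨MvPolynomial.C (f τ) * P, ?_, fun z => by simp [hP']⟩
    simpa using (MvPolynomial.isHomogeneous_C _ (f τ)).mul hP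
  · exact (modularForm_bounded f).mul (hφ.bounded z₁ z₂ z₃ hΛ)

/-- The product of a modular form and a triality invariant. -/
def modularSMul {m : ℕ} {i j : ℤ} (f : ModularForm 𝒮ℒ i) (φ : invariants m j) : invariants m (i + j) :=
  ⟨fun τ z => f τ * φ.1 τ z, IsTrialityInvariant.modularForm_mul f φ.2⟩

lemma modularSMul_apply {m : ℕ} {i j : ℤ} (f : ModularForm 𝒮ℒ i) (φ : invariants m j) (τ : ℍ)
    (z : Fin 4 → ℂ) : (modularSMul f φ).1 τ z = f τ * φ.1 τ z := rfl

lemma graded_ext {m : ℕ} {x y : GradedMonoid fun k => invariants m k} (h : x.1 = y.1)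
    (h' : ∀ τ z, x.2.1 τ z = y.2.1 τ z) : x = y := by
  obtain ⟨k, φ⟩ := x
  obtain ⟨l, ψ⟩ := y
  obtain rfl : k = l := h
  congr 1
  exact Subtype.ext (funext₂ h')

/-- `R_{*,m}` is a graded module over the graded ring of modular forms. -/
instance gradedModule (m : ℕ) :
    DirectSum.Gmodule (fun k : ℤ => ModularForm 𝒮ℒ k) (fun k => invariants m k) where
  smul f φ := modularSMul f φ
  one_smul x := graded_ext (zero_add _) fun τ z => one_mul (x.2.1 τ z)
  mul_smul f g x := graded_ext (add_assoc _ _ _) fun τ z => mul_assoc (f.2 τ) (g.2 τ) (x.2.1 τ z)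
  smul_add f φ ψ := Subtype.ext (funext₂ fun τ z => mul_add (f τ) (φ.1 τ z) (ψ.1 τ z))
  smul_zero f := Subtype.ext (funext₂ fun τ _ => mul_zero (f τ))
  add_smul f g φ := Subtype.ext (funext₂ fun τ z => add_mul (f τ) (g τ) (φ.1 τ z))
  zero_smul φ := Subtype.ext (funext₂ fun τ z => zero_mul (φ.1 τ z))

/-- The graded ring `M_*` of modular forms for `SL₂(ℤ)`. -/
abbrev ModularRing : Type := ⨁ k : ℤ, ModularForm 𝒮ℒ k

/-- The module `R_{*,m}` of triality invariants of degree `m`. -/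
abbrev InvariantModule (m : ℕ) : Type := ⨁ k : ℤ, invariants m k


end Triality

end

/-!
The rank of `R_{*,m}` is the dimension of the space of invariants of degree `m` of `W(D₄)`: at a
generic point `τ` the triality invariants have no constraint but the invariance under `W(D₄)`. By
Chevalley's theorem (`IsD4Invariant.mem_adjoin`, `algebraicIndependent_gens`) the invariants of
`W(D₄)` form a polynomial ring on generators of degrees `2`, `4`, `4`, `6`, which gives the
generating function.

To make this precise, generators that depend on `τ` are used. The group `W(F₄) / W(D₄)` fixes the
generators of degrees `2` and `6`, chosen suitably, and permutes three quartic invariants with sum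
zero. The group `SL₂(ℤ) / Γ(2)` permutes in the same way, up to the factor of automorphy of weight
`4`, the three functions `16 E₄(2τ)`, `E₄(τ / 2)`, `E₄((τ + 1) / 2)`. If `e j` denotes these
functions and `u j` these quartics, then `∑ e j u j` and `∑ e j ^ 2 u j` obey the transformation law
of a triality invariant of weight `4` and `8` (`gensAt_transform`), and they span the invariant
quartics modulo the square of the quadratic one wherever the `e j` are distinct. The product of
`Δ ^ m` and a monomial of degree `m` in these generators also meets the cusp condition, so it is a
triality invariant (`isTrialityInvariant_monomialInvariant`).

These products are linearly independent over the modular forms, since their values at a generic `τ`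
are linearly independent (`eq_zero_of_sum_monomialInvariant`); this bounds the rank from below. For
the upper bound, pair two triality invariants `φ` and `ψ` by summing `φ τ y * ψ τ y` over a finite
family of real points `y` that the group generated by `wS` and `wT` permutes. The result is a
modular form of level one; it is bounded at the cusp because `φ τ y` is, for fixed `y`
(`IsTrialityInvariant.bounded_apply`). If all pairings of `φ` with the products above vanish, then
so does, at a generic `τ`, the sum of the squares of the absolute values of `φ τ` over that family,
and the family is large enough to conclude that `φ = 0` (`eq_zero_of_pairing_eq_zero`). So pairing with
the products embeds `R_{*,m}` into a free module over the modular forms, whose rank is the number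
of products.
-/

noncomputable section

open scoped ModularForm
open Matrix MatrixGroups UpperHalfPlane CongruenceSubgroup Filter Topology DirectSum

namespace Triality

/-! ### Invariants of the Weyl group of type `D₄` -/

/-- The polynomial `P` is invariant under `W(D₄)`. -/
def IsD4Invariant (P : MvPolynomial (Fin 4) ℂ) : Prop :=
  ∀ g ∈ WD4, ∀ z, MvPolynomial.eval ((g : Matrix (Fin 4) (Fin 4) ℂ) *ᵥ z) P =
    MvPolynomial.eval z P

section Polynomials

open MvPolynomial

/-- The `k`-th elementary symmetric polynomial in the squares of the variables. -/
def esymmSq (k : ℕ) : MvPolynomial (Fin 4) ℂ := expand 2 (esymm (Fin 4) ℂ k)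

/-- The product of the variables, whose square is `esymmSq 4`. -/
def pfaffian : MvPolynomial (Fin 4) ℂ := X 0 * X 1 * X 2 * X 3

lemma esymmSq_one : esymmSq 1 = X 0 ^ 2 + X 1 ^ 2 + X 2 ^ 2 + X 3 ^ 2 := by
  simp [esymmSq, esymm_one, Fin.sum_univ_four]

lemma esymmSq_two : esymmSq 2 = X 0 ^ 2 * X 1 ^ 2 + X 0 ^ 2 * X 2 ^ 2 + X 0 ^ 2 * X 3 ^ 2 +
    X 1 ^ 2 * X 2 ^ 2 + X 1 ^ 2 * X 3 ^ 2 + X 2 ^ 2 * X 3 ^ 2 := by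
  have : Finset.powersetCard 2 (Finset.univ : Finset (Fin 4)) =
    {{0, 1}, {0, 2}, {0, 3}, {1, 2}, {1, 3}, {2, 3}} := by decide
  rw [esymmSq, esymm, this]
  repeat rw [Finset.sum_insert (by decide)]
  simp
  ring

lemma esymmSq_three : esymmSq 3 = X 0 ^ 2 * X 1 ^ 2 * X 2 ^ 2 + X 0 ^ 2 * X 1 ^ 2 * X 3 ^ 2 +
    X 0 ^ 2 * X 2 ^ 2 * X 3 ^ 2 + X 1 ^ 2 * X 2 ^ 2 * X 3 ^ 2 := by
  have : Finset.powersetCard 3 (Finset.univ : Finset (Fin 4)) =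
    {{0, 1, 2}, {0, 1, 3}, {0, 2, 3}, {1, 2, 3}} := by decide
  rw [esymmSq, esymm, this]
  repeat rw [Finset.sum_insert (by decide)]
  simp
  ring

lemma esymmSq_four : esymmSq 4 = pfaffian ^ 2 := by
  have : Finset.powersetCard 4 (Finset.univ : Finset (Fin 4)) = {{0, 1, 2, 3}} := by decide
  rw [esymmSq, esymm, this, pfaffian]
  simp
  ring

/-- Every coordinate is a root of the monic polynomial `∏ (T ^ 2 - X j ^ 2)`. -/
lemma coordinate_relation (i : Fin 4) : (X i : MvPolynomial (Fin 4) ℂ) ^ 8 - esymmSq 1 * X i ^ 6 +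
    esymmSq 2 * X i ^ 4 - esymmSq 3 * X i ^ 2 + pfaffian ^ 2 = 0 := by
  rw [esymmSq_one, esymmSq_two, esymmSq_three, pfaffian]
  fin_cases i <;> simp <;> ring

lemma eval_aeval {σ τ : Type*} (f : σ → MvPolynomial τ ℂ) (P : MvPolynomial σ ℂ) (z : τ → ℂ) :
    eval z (aeval f P) = eval (fun i => eval z (f i)) P := by
  simp only [← coe_aeval_eq_eval, RingHom.coe_coe, comp_aeval_apply]

lemma coeff_aeval_C_mul_X (c : Fin 4 → ℂ) (P : MvPolynomial (Fin 4) ℂ) (a : Fin 4 →₀ ℕ) :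
    coeff a (aeval (fun i => C (c i) * X i : Fin 4 → MvPolynomial (Fin 4) ℂ) P) =
      (∏ i, c i ^ a i) * coeff a P := by
  induction P using MvPolynomial.induction_on' with
  | monomial b r =>
    have : aeval (fun i => C (c i) * X i : Fin 4 → MvPolynomial (Fin 4) ℂ) (monomial b r) =
        monomial b ((∏ i, c i ^ b i) * r) := by
      rw [aeval_monomial, Finsupp.prod_fintype _ _ (by simp), monomial_eq (a := (∏ i, c i ^ b i) * r),
        Finsupp.prod_fintype _ _ (by simp)]
      simp only [mul_pow, Finset.prod_mul_distrib, map_mul, map_prod, map_pow, algebraMap_eq]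
      ring
    rw [this, coeff_monomial, coeff_monomial]
    split_ifs with h
    · rw [h]
    · simp
  | add p q hp hq => rw [map_add, coeff_add, coeff_add, hp, hq, mul_add]

/-- The linear map `z ↦ z ∘ swap i j` is the reflection in `e_i - e_j`. -/
lemma IsD4Invariant.rename_swap {P : MvPolynomial (Fin 4) ℂ} (hP : IsD4Invariant P) {i j : Fin 4}
    (hij : i ≠ j) : rename (Equiv.swap i j) P = P := by
  have hr : (Pi.single i 1 - Pi.single j 1 : Fin 4 → ℂ) ∈ rootsD4 := by
    refine ⟨fun k => ⟨(Pi.single i 1 - Pi.single j 1 : Fin 4 → ℤ) k, ?_⟩, ?_⟩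
    · simp [Pi.single_apply]
    · simp [hij, Ne.symm hij]; norm_num
  have h0 : (Pi.single i 1 - Pi.single j 1 : Fin 4 → ℂ) ⬝ᵥ (Pi.single i 1 - Pi.single j 1) ≠ 0 := by
    rw [hr.2]; norm_num
  apply MvPolynomial.funext
  intro z
  rw [eval_rename, ← hP _ (Subgroup.subset_closure ⟨_, hr, rfl⟩ : reflectionGL _ h0 ∈ WD4) z]
  refine congrArg (fun y => eval y P) ?_
  change _ = reflectionMatrix _ *ᵥ _
  rw [reflectionMatrix, hr.2, sub_mulVec, one_mulVec, div_self two_ne_zero, one_smul,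
      vecMulVec_mulVec]
  ext k
  rcases eq_or_ne k i with rfl | hk
  · simp [hij, sub_dotProduct]
  · rcases eq_or_ne k j with rfl | hk'
    · simp [hij.symm, sub_dotProduct]
    · simp [hk, hk', Equiv.swap_apply_of_ne_of_ne]

lemma IsD4Invariant.rename_perm {P : MvPolynomial (Fin 4) ℂ} (hP : IsD4Invariant P)
    (σ : Equiv.Perm (Fin 4)) : rename σ P = P := by
  induction σ using Equiv.Perm.swap_induction_on with
  | one => simp
  | swap_mul f x y hxy ih =>
    rw [Equiv.Perm.coe_mul, ← rename_rename, ih, hP.rename_swap hxy]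

/-- The product of the reflections in `e_i - e_j` and `e_i + e_j` changes two signs. -/
lemma IsD4Invariant.even_add {P : MvPolynomial (Fin 4) ℂ} (hP : IsD4Invariant P) {i j : Fin 4}
    (hij : i ≠ j) {a : Fin 4 →₀ ℕ} (ha : coeff a P ≠ 0) : Even (a i + a j) := by
  have hr : (Pi.single i 1 + Pi.single j 1 : Fin 4 → ℂ) ∈ rootsD4 := by
    refine ⟨fun k => ⟨(Pi.single i 1 + Pi.single j 1 : Fin 4 → ℤ) k, ?_⟩, ?_⟩
    · simp [Pi.single_apply]
    · simp [hij, Ne.symm hij]; norm_num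
  have h0 : (Pi.single i 1 + Pi.single j 1 : Fin 4 → ℂ) ⬝ᵥ (Pi.single i 1 + Pi.single j 1) ≠ 0 := by
    rw [hr.2]; norm_num
  let c : Fin 4 → ℂ := fun k => if k = i ∨ k = j then -1 else 1
  have key : aeval (fun i => C (c i) * X i : Fin 4 → MvPolynomial (Fin 4) ℂ) P = P := by
    apply MvPolynomial.funext
    intro z
    rw [eval_aeval,
      ← hP _ (Subgroup.subset_closure ⟨_, hr, rfl⟩ : reflectionGL _ h0 ∈ WD4) z]
    conv_lhs => rw [← hP.rename_swap hij, eval_rename]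
    refine congrArg (fun y => eval y P) ?_
    change _ = reflectionMatrix _ *ᵥ _
    rw [reflectionMatrix, hr.2, sub_mulVec, one_mulVec, div_self two_ne_zero, one_smul,
      vecMulVec_mulVec]
    ext k
    rcases eq_or_ne k i with rfl | hk
    · simp [hij, hij.symm, add_dotProduct, c]
    · rcases eq_or_ne k j with rfl | hk'
      · simp [hij, hij.symm, add_dotProduct, c]
      · simp [hk, hk', Equiv.swap_apply_of_ne_of_ne, c]
  have h1 := coeff_aeval_C_mul_X c P a
  rw [key] at h1
  have h2 : ∏ k, c k ^ a k = (-1) ^ (a i + a j) := by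
    rw [← Finset.prod_subset (Finset.subset_univ {i, j}) (by
      intro k _ hk
      simp only [Finset.mem_insert, Finset.mem_singleton] at hk
      simp [c, hk]), Finset.prod_pair hij]
    simp [c, pow_add]
  rw [h2] at h1
  by_contra hodd
  rw [Nat.not_even_iff_odd] at hodd
  rw [hodd.neg_one_pow] at h1
  exact ha (by linear_combination h1 / 2)

/-- Halving the exponents, rounding down. -/
def halve (a : Fin 4 →₀ ℕ) : Fin 4 →₀ ℕ := a.mapRange (· / 2) rfl

lemma monomial_eq_expand {a : Fin 4 →₀ ℕ} (ha : ∀ i, Even (a i)) (c : ℂ) :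
    monomial a c = expand 2 (monomial (halve a) c) := by
  rw [expand_monomial]
  congr 2
  ext i
  simp [halve, Nat.mul_div_cancel' (ha i).two_dvd]

lemma monomial_eq_pfaffian_mul_expand {a : Fin 4 →₀ ℕ} (ha : ∀ i, Odd (a i)) (c : ℂ) :
    monomial a c = pfaffian * expand 2 (monomial (halve a) c) := by
  have hp : pfaffian = monomial (Finsupp.equivFunOnFinite.symm fun _ => 1) 1 := by
    rw [monomial_eq, Finsupp.prod_fintype _ _ (by simp)]
    simp [pfaffian, Fin.prod_univ_four]
  rw [expand_monomial, hp, monomial_mul, one_mul]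
  congr 2
  ext i
  obtain ⟨k, hk⟩ := ha i
  simp [halve, hk]
  omega

/-- An invariant of `W(D₄)` is `A + p B` with `A` and `B` polynomials in the squares of the
variables and `p` the Pfaffian, because in each of its monomials all exponents have the same
parity. -/
lemma IsD4Invariant.exists_expand {P : MvPolynomial (Fin 4) ℂ} (hP : IsD4Invariant P) :
    ∃ A B : MvPolynomial (Fin 4) ℂ, P = expand 2 A + pfaffian * expand 2 B := by
  classical
  refine ⟨∑ a ∈ P.support with Even (a 0), monomial (halve a) (coeff a P),
    ∑ a ∈ P.support with ¬ Even (a 0), monomial (halve a) (coeff a P), ?_⟩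
  conv_lhs => rw [P.as_sum, ← Finset.sum_filter_add_sum_filter_not _ fun a => Even (a 0)]
  rw [map_sum, map_sum, Finset.mul_sum]
  have hpar : ∀ a ∈ P.support, ∀ i, (Even (a i) ↔ Even (a 0)) := by
    intro a ha i
    rcases eq_or_ne i 0 with rfl | hi
    · rfl
    · exact Nat.even_add.1 (hP.even_add hi (mem_support_iff.1 ha))
  congr 1
  · refine Finset.sum_congr rfl fun a ha => ?_
    rw [Finset.mem_filter] at ha
    exact monomial_eq_expand (fun i => (hpar a ha.1 i).2 ha.2) _
  · refine Finset.sum_congr rfl fun a ha => ?_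
    rw [Finset.mem_filter] at ha
    refine monomial_eq_pfaffian_mul_expand (fun i => Nat.not_even_iff_odd.1 fun h => ?_) _
    exact ha.2 ((hpar a ha.1 i).1 h)

lemma pfaffian_ne_zero : pfaffian ≠ 0 := by
  simp [pfaffian, X_ne_zero]

/-- The change of sign of the last variable separates the two summands. -/
lemma expand_add_pfaffian_mul_inj {A B A' B' : MvPolynomial (Fin 4) ℂ}
    (h : expand 2 A + pfaffian * expand 2 B = expand 2 A' + pfaffian * expand 2 B') :
    A = A' ∧ B = B' := by
  let F : MvPolynomial (Fin 4) ℂ →ₐ[ℂ] MvPolynomial (Fin 4) ℂ :=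
    aeval ![X 0, X 1, X 2, -X 3]
  have hF : ∀ A, F (expand 2 A) = expand 2 A := by
    intro A
    apply MvPolynomial.funext
    intro z
    rw [eval_aeval, eval_expand, eval_expand]
    congr 2
    ext i
    fin_cases i <;> simp
  have hpf : F pfaffian = -pfaffian := by simp [F, pfaffian]
  have h' := congrArg F h
  simp only [map_add, map_mul, hF, hpf] at h'
  have h2 : (2 : MvPolynomial (Fin 4) ℂ) ≠ 0 := two_ne_zero
  constructor
  · refine expand_injective two_pos (mul_left_cancel₀ h2 ?_)
    linear_combination h + h'
  · refine expand_injective two_pos (mul_left_cancel₀ pfaffian_ne_zero (mul_left_cancel₀ h2 ?_))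
    linear_combination h - h'

lemma rename_pfaffian (σ : Equiv.Perm (Fin 4)) : rename σ pfaffian = pfaffian := by
  have : pfaffian = ∏ i, X i := by rw [Fin.prod_univ_four, pfaffian]
  rw [this, map_prod]
  simp only [rename_X]
  exact Equiv.prod_comp σ fun i => (X i : MvPolynomial (Fin 4) ℂ)

lemma expand_symmetric_mem_adjoin {A : MvPolynomial (Fin 4) ℂ} (hA : A.IsSymmetric) :
    expand 2 A ∈ Algebra.adjoin ℂ {esymmSq 1, esymmSq 2, pfaffian, esymmSq 3} := by
  obtain ⟨Q, hQ⟩ := esymmAlgHom_surjective (σ := Fin 4) (n := 4) ℂ (by simp) ⟨A, hA⟩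
  have hQ' := congrArg Subtype.val hQ
  rw [esymmAlgHom_apply] at hQ'
  simp only at hQ'
  rw [← hQ', comp_aeval_apply]
  have hx (i : Fin 4) : expand 2 (esymm (Fin 4) ℂ (i + 1)) ∈
      Algebra.adjoin ℂ {esymmSq 1, esymmSq 2, pfaffian, esymmSq 3} := by
    change esymmSq (i + 1) ∈ _
    fin_cases i
    · exact Algebra.subset_adjoin (by simp)
    · exact Algebra.subset_adjoin (by simp)
    · exact Algebra.subset_adjoin (by simp)
    · change esymmSq 4 ∈ _
      rw [esymmSq_four]
      exact pow_mem (Algebra.subset_adjoin (by simp)) 2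
  refine Algebra.adjoin_le ?_ ((Algebra.adjoin_range_eq_range_aeval ℂ _).ge ⟨Q, rfl⟩)
  rintro _ ⟨i, rfl⟩
  exact hx i

/-- Chevalley's theorem for `W(D₄)`: the invariants are generated by the elementary symmetric
polynomials of the squares together with the Pfaffian. -/
theorem IsD4Invariant.mem_adjoin {P : MvPolynomial (Fin 4) ℂ} (hP : IsD4Invariant P) :
    P ∈ Algebra.adjoin ℂ {esymmSq 1, esymmSq 2, pfaffian, esymmSq 3} := by
  obtain ⟨A, B, h⟩ := hP.exists_expand
  have hs : ∀ σ : Equiv.Perm (Fin 4), rename σ A = A ∧ rename σ B = B := by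
    intro σ
    apply expand_add_pfaffian_mul_inj
    rw [← h, ← rename_expand, ← rename_expand]
    conv_lhs => rw [← rename_pfaffian σ]
    rw [← map_mul, ← map_add, ← h, hP.rename_perm]
  rw [h]
  refine add_mem (expand_symmetric_mem_adjoin fun σ => (hs σ).1)
    (mul_mem (Algebra.subset_adjoin (by simp)) (expand_symmetric_mem_adjoin fun σ => (hs σ).2))

/-- The quartic `(∑ z i ^ 2) ^ 2 / 4 - ∑ i < j, z i ^ 2 z j ^ 2`. Twice this quartic is the
member fixed by `wT` of a triple of quartics with sum zero that `W(F₄) / W(D₄)` permutes. -/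
def quartic : MvPolynomial (Fin 4) ℂ := C (1 / 4) * esymmSq 1 ^ 2 - esymmSq 2

/-- A sextic invariant of `W(F₄)`. -/
def sextic : MvPolynomial (Fin 4) ℂ :=
  esymmSq 1 ^ 3 + 2 * esymmSq 1 * esymmSq 2 - C 12 * esymmSq 3

/-- Generators of the algebra of invariants of `W(D₄)`, in which the two quartics are chosen as
combinations of `quartic` and `pfaffian`. -/
def gens (a b c d : ℂ) : Fin 4 → MvPolynomial (Fin 4) ℂ :=
  ![esymmSq 1, C a * quartic + C b * pfaffian, C c * quartic + C d * pfaffian, sextic]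

lemma adjoin_le_adjoin_gens {a b c d : ℂ} (h : a * d - b * c ≠ 0) :
    Algebra.adjoin ℂ {esymmSq 1, esymmSq 2, pfaffian, esymmSq 3} ≤
      Algebra.adjoin ℂ (Set.range (gens a b c d)) := by
  set S := Algebra.adjoin ℂ (Set.range (gens a b c d))
  have hg (i) : gens a b c d i ∈ S := Algebra.subset_adjoin ⟨i, rfl⟩
  have hC (r : ℂ) : C r ∈ S := S.algebraMap_mem r
  have h1 : esymmSq 1 ∈ S := hg 0
  have e (r : ℂ) (hr : r ≠ 0) : (C r⁻¹ : MvPolynomial (Fin 4) ℂ) * C r = 1 := by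
    rw [← C_mul, inv_mul_cancel₀ hr, C_1]
  have hq : quartic ∈ S := by
    have : quartic = C (a * d - b * c)⁻¹ * (C d * gens a b c d 1 - C b * gens a b c d 2) := by
      have := e _ h
      simp only [gens, C_sub, C_mul] at this ⊢
      simp
      linear_combination (-quartic) * this
    rw [this]
    exact mul_mem (hC _) (sub_mem (mul_mem (hC _) (hg _)) (mul_mem (hC _) (hg _)))
  have hp : pfaffian ∈ S := by
    have : pfaffian = C (a * d - b * c)⁻¹ * (C a * gens a b c d 2 - C c * gens a b c d 1) := by
      have := e _ h
      simp only [gens, C_sub, C_mul] at this ⊢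
      simp
      linear_combination (-pfaffian) * this
    rw [this]
    exact mul_mem (hC _) (sub_mem (mul_mem (hC _) (hg _)) (mul_mem (hC _) (hg _)))
  have h2 : esymmSq 2 ∈ S := by
    have : esymmSq 2 = C (1 / 4) * esymmSq 1 ^ 2 - quartic := by rw [quartic]; ring
    rw [this]
    exact sub_mem (mul_mem (hC _) (pow_mem h1 2)) hq
  have h3 : esymmSq 3 ∈ S := by
    have : esymmSq 3 =
        C 12⁻¹ * (esymmSq 1 ^ 3 + C 2 * esymmSq 1 * esymmSq 2 - gens a b c d 3) := by
      have e12 := e 12 (by norm_num)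
      have e2 : (C 2 : MvPolynomial (Fin 4) ℂ) = 2 := map_ofNat C 2
      change _ = C 12⁻¹ * (_ - sextic)
      rw [sextic, e2]
      linear_combination (-esymmSq 3) * e12
    rw [this]
    exact mul_mem (hC _) (sub_mem (add_mem (pow_mem h1 3) (mul_mem (mul_mem (hC _) h1) h2)) (hg 3))
  refine Algebra.adjoin_le ?_
  rintro x (rfl | rfl | rfl | rfl)
  exacts [h1, h2, hp, h3]

/-- The generators are algebraically independent: there are as many of them as variables, and the
variables are integral over the algebra that they generate. -/
lemma algebraicIndependent_gens {a b c d : ℂ} (h : a * d - b * c ≠ 0) :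
    AlgebraicIndependent ℂ (gens a b c d) := by
  set S := Algebra.adjoin ℂ (Set.range (gens a b c d)) with hS
  have hX (i : Fin 4) : IsIntegral S (X i : MvPolynomial (Fin 4) ℂ) := by
    have hle := adjoin_le_adjoin_gens h
    obtain ⟨s1, hs1⟩ : ∃ s : S, (s : MvPolynomial (Fin 4) ℂ) = esymmSq 1 :=
      ⟨⟨esymmSq 1, hle (Algebra.subset_adjoin (by simp))⟩, rfl⟩
    obtain ⟨s2, hs2⟩ : ∃ s : S, (s : MvPolynomial (Fin 4) ℂ) = esymmSq 2 :=
      ⟨⟨esymmSq 2, hle (Algebra.subset_adjoin (by simp))⟩, rfl⟩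
    obtain ⟨s3, hs3⟩ : ∃ s : S, (s : MvPolynomial (Fin 4) ℂ) = esymmSq 3 :=
      ⟨⟨esymmSq 3, hle (Algebra.subset_adjoin (by simp))⟩, rfl⟩
    obtain ⟨p, hp⟩ : ∃ s : S, (s : MvPolynomial (Fin 4) ℂ) = pfaffian :=
      ⟨⟨pfaffian, hle (Algebra.subset_adjoin (by simp))⟩, rfl⟩
    refine ⟨Polynomial.X ^ 8 - Polynomial.C s1 * Polynomial.X ^ 6 +
      Polynomial.C s2 * Polynomial.X ^ 4 - Polynomial.C s3 * Polynomial.X ^ 2 +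
      Polynomial.C (p ^ 2), by monicity!, ?_⟩
    simp only [Polynomial.eval₂_add, Polynomial.eval₂_sub, Polynomial.eval₂_mul,
      Polynomial.eval₂_pow, Polynomial.eval₂_X, Polynomial.eval₂_C, map_pow]
    change X i ^ 8 - (s1 : MvPolynomial (Fin 4) ℂ) * _ + (s2 : MvPolynomial (Fin 4) ℂ) * _ -
      (s3 : MvPolynomial (Fin 4) ℂ) * _ + (p : MvPolynomial (Fin 4) ℂ) ^ 2 = 0
    rw [hs1, hs2, hs3, hp]
    exact coordinate_relation i
  have hint : Algebra.IsIntegral S (MvPolynomial (Fin 4) ℂ) := by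
    refine ⟨fun P => ?_⟩
    have hle : Algebra.adjoin ℂ (Set.range (X : Fin 4 → MvPolynomial (Fin 4) ℂ)) ≤
        (integralClosure S (MvPolynomial (Fin 4) ℂ)).restrictScalars ℂ := by
      refine Algebra.adjoin_le ?_
      rintro _ ⟨i, rfl⟩
      exact hX i
    rw [adjoin_range_X] at hle
    exact hle (Algebra.mem_top : P ∈ _)
  have halg : Algebra.IsAlgebraic S (MvPolynomial (Fin 4) ℂ) := inferInstance
  exact (Algebra.IsAlgebraic.isTranscendenceBasis_of_le_trdeg_of_finite ℂ (gens a b c d)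
    (by rw [trdeg_of_isDomain]; simp)).1

/-- The degrees of the generators. -/
def genDegree : Fin 4 → ℕ := ![2, 4, 4, 6]

lemma isHomogeneous_esymmSq (k : ℕ) : (esymmSq k).IsHomogeneous (2 * k) := by
  rw [esymmSq, esymm, map_sum]
  refine IsHomogeneous.sum _ _ _ fun t ht => ?_
  rw [map_prod]
  have := IsHomogeneous.prod t (fun i => expand 2 (X i : MvPolynomial (Fin 4) ℂ)) (fun _ => 2)
    fun i _ => by rw [expand_X]; exact isHomogeneous_X_pow i 2
  simpa [(Finset.mem_powersetCard.1 ht).2, mul_comm] using this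

lemma isHomogeneous_gens (a b c d : ℂ) (i : Fin 4) :
    (gens a b c d i).IsHomogeneous (genDegree i) := by
  have h1 := isHomogeneous_esymmSq 1
  have h2 := isHomogeneous_esymmSq 2
  have h3 := isHomogeneous_esymmSq 3
  have hp : pfaffian.IsHomogeneous 4 :=
    (((isHomogeneous_X ℂ 0).mul (isHomogeneous_X ℂ 1)).mul (isHomogeneous_X ℂ 2)).mul
      (isHomogeneous_X ℂ 3)
  have hq : quartic.IsHomogeneous 4 := ((h1.pow 2).C_mul _).sub h2
  have h12 : (2 * esymmSq 1 * esymmSq 2).IsHomogeneous 6 := by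
    rw [show (2 : MvPolynomial (Fin 4) ℂ) = C 2 from (map_ofNat C 2).symm]
    exact (h1.C_mul _).mul h2
  have hs : sextic.IsHomogeneous 6 := ((h1.pow 3).add h12).sub (h3.C_mul _)
  fin_cases i
  · exact h1
  · exact (hq.C_mul _).add (hp.C_mul _)
  · exact (hq.C_mul _).add (hp.C_mul _)
  · exact hs

/-- The exponents of the monomials of degree `m` in the generators. -/
def Exponents (m : ℕ) : Type := {a : Fin 4 →₀ ℕ // ∑ i, genDegree i * a i = m}

lemma exponents_le {m : ℕ} (e : Exponents m) (i : Fin 4) : e.1 i ≤ m := by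
  calc e.1 i ≤ genDegree i * e.1 i :=
        Nat.le_mul_of_pos_left _ (by fin_cases i <;> simp [genDegree])
    _ ≤ ∑ j, genDegree j * e.1 j :=
        Finset.single_le_sum (f := fun j => genDegree j * e.1 j) (fun _ _ => Nat.zero_le _)
          (Finset.mem_univ i)
    _ = m := e.2

instance (m : ℕ) : Finite (Exponents m) := by
  refine Finite.of_injective
    (fun e : Exponents m => fun i => (⟨e.1 i, Nat.lt_succ_of_le (exponents_le e i)⟩ : Fin (m + 1)))
    fun e e' h => Subtype.ext (Finsupp.ext fun i => ?_)
  simpa using congrFun h i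

instance (m : ℕ) : Fintype (Exponents m) := Fintype.ofFinite _

lemma isHomogeneous_prod_gens (a b c d : ℂ) (e : Fin 4 →₀ ℕ) :
    (∏ i, gens a b c d i ^ e i).IsHomogeneous (∑ i, genDegree i * e i) :=
  IsHomogeneous.prod _ _ _ fun i _ => (isHomogeneous_gens a b c d i).pow _

/-- The monomials in the generators are linearly independent. -/
lemma eq_zero_of_sum_prod_gens_eq_zero {a b c d : ℂ} (h : a * d - b * c ≠ 0) {m : ℕ}
    (r : Exponents m → ℂ) (hr : ∑ e, C (r e) * ∏ i, gens a b c d i ^ e.1 i = 0) : r = 0 := by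
  have h0 : ∑ e : Exponents m, monomial e.1 (r e) = 0 := by
    apply algebraicIndependent_gens h
    rw [map_zero, map_sum, ← hr]
    refine Finset.sum_congr rfl fun e _ => ?_
    rw [aeval_monomial, Finsupp.prod_fintype _ _ (by simp), algebraMap_eq]
  ext e
  have h1 := congrArg (coeff e.1) h0
  rw [coeff_sum, Finset.sum_eq_single e, coeff_monomial, if_pos rfl] at h1
  · exact h1
  · intro e' _ he
    rw [coeff_monomial, if_neg fun h => he (Subtype.ext h)]
  · simp

/-- The monomials in the generators of the right degree span the invariants of degree `m`. -/
lemma IsD4Invariant.exists_sum_prod_gens {a b c d : ℂ} (h : a * d - b * c ≠ 0) {m : ℕ}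
    {P : MvPolynomial (Fin 4) ℂ} (hP : IsD4Invariant P) (hm : P.IsHomogeneous m) :
    ∃ r : Exponents m → ℂ, P = ∑ e, C (r e) * ∏ i, gens a b c d i ^ e.1 i := by
  classical
  have hmem := adjoin_le_adjoin_gens h hP.mem_adjoin
  rw [Algebra.adjoin_range_eq_range_aeval] at hmem
  obtain ⟨Q, hQ⟩ := hmem
  refine ⟨fun e => coeff e.1 Q, ?_⟩
  have h1 : aeval (gens a b c d) Q =
      ∑ e ∈ Q.support, C (coeff e Q) * ∏ i, gens a b c d i ^ e i := by
    rw [aeval_def, eval₂_eq']; rfl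
  have h2 : P = homogeneousComponent m P := by
    rw [homogeneousComponent_of_mem hm, if_pos rfl]
  have hQ' : P = aeval (gens a b c d) Q := hQ.symm
  rw [h2, hQ', h1, map_sum]
  have h3 (e : Fin 4 →₀ ℕ) : homogeneousComponent m (C (coeff e Q) * ∏ i, gens a b c d i ^ e i) =
      if ∑ i, genDegree i * e i = m then C (coeff e Q) * ∏ i, gens a b c d i ^ e i else 0 := by
    rw [homogeneousComponent_of_mem ((isHomogeneous_prod_gens a b c d e).C_mul _)]
    simp only [eq_comm]
  simp only [h3]
  rw [← Finset.sum_filter]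
  have h4 : ∑ e : Exponents m, C (coeff e.1 Q) * ∏ i, gens a b c d i ^ e.1 i =
      ∑ e ∈ Finset.univ.map ⟨fun e : Exponents m => e.1, Subtype.val_injective⟩,
        C (coeff e Q) * ∏ i, gens a b c d i ^ e i := by
    rw [Finset.sum_map]; rfl
  rw [h4]
  refine Finset.sum_subset (fun e he => ?_) fun e he he' => ?_
  · rw [Finset.mem_filter] at he
    exact Finset.mem_map.2 ⟨⟨e, he.2⟩, Finset.mem_univ _, rfl⟩
  · obtain ⟨e, -, rfl⟩ := Finset.mem_map.1 he
    have h5 : coeff e.1 Q = 0 := by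
      by_contra h5
      exact he' (Finset.mem_filter.2 ⟨mem_support_iff.2 h5, e.2⟩)
    change C (coeff e.1 Q) * _ = 0
    rw [h5, C_0, zero_mul]

end Polynomials

/-! ### Three modular forms of level two -/

/-- The Eisenstein series `E₄` as a function on the complex plane, with junk values off the upper
half plane. -/
def eisFour (t : ℂ) : ℂ := ModularForm.E₄ (ofComplex t)

lemma eisFour_add_one {t : ℂ} (ht : 0 < t.im) : eisFour (t + 1) = eisFour t := by
  have h := modularForm_transform ModularForm.E₄ ModularGroup.T ⟨t, ht⟩
  rw [ModularGroup.denom_apply, modular_T_smul] at h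
  have ht' : 0 < (t + 1).im := by simpa using ht
  rw [eisFour, eisFour, ofComplex_apply_of_im_pos ht, ofComplex_apply_of_im_pos ht']
  convert h using 2
  · apply UpperHalfPlane.ext
    simp [add_comm]
  · simp [ModularGroup.T]

lemma eisFour_neg_inv {t : ℂ} (ht : 0 < t.im) : eisFour (-t⁻¹) = t ^ 4 * eisFour t := by
  have h := modularForm_transform ModularForm.E₄ ModularGroup.S ⟨t, ht⟩
  rw [ModularGroup.denom_apply, modular_S_smul] at h
  have ht' : 0 < (-t⁻¹).im := by
    have := (UpperHalfPlane.mk (-t)⁻¹ (UpperHalfPlane.im_inv_neg_coe_pos ⟨t, ht⟩)).2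
    rw [← inv_neg]
    exact this
  rw [eisFour, eisFour, ofComplex_apply_of_im_pos ht, ofComplex_apply_of_im_pos ht']
  convert h using 2
  · apply UpperHalfPlane.ext
    simp [inv_neg]
  · simp [ModularGroup.S]

/-- The modular forms `16 E₄(2τ)`, `E₄(τ / 2)`, `E₄((τ + 1) / 2)` of weight `4` for `Γ(2)`, which
`SL₂(ℤ)` permutes. -/
def eisTriple (j : Fin 3) (τ : ℍ) : ℂ :=
  ![16 * eisFour (2 * τ), eisFour (τ / 2), eisFour ((τ + 1) / 2)] j

lemma coe_T_smul (τ : ℍ) : ((ModularGroup.T • τ : ℍ) : ℂ) = τ + 1 := by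
  rw [modular_T_smul]; simp [add_comm]

lemma coe_S_smul (τ : ℍ) : ((ModularGroup.S • τ : ℍ) : ℂ) = -(τ : ℂ)⁻¹ := by
  rw [modular_S_smul]; simp [inv_neg]

lemma eisTriple_T (τ : ℍ) : eisTriple 0 (ModularGroup.T • τ) = eisTriple 0 τ ∧
    eisTriple 1 (ModularGroup.T • τ) = eisTriple 2 τ ∧
    eisTriple 2 (ModularGroup.T • τ) = eisTriple 1 τ := by
  have hτ : 0 < (τ : ℂ).im := τ.2
  simp only [eisTriple, coe_T_smul]
  refine ⟨?_, ?_, ?_⟩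
  · change 16 * eisFour (2 * (τ + 1)) = 16 * eisFour (2 * τ)
    rw [show (2 * (τ + 1) : ℂ) = 2 * τ + 1 + 1 by ring, eisFour_add_one, eisFour_add_one] <;>
      simpa using hτ
  · rfl
  · change eisFour ((τ + 1 + 1) / 2) = eisFour (τ / 2)
    rw [show ((τ + 1 + 1) / 2 : ℂ) = τ / 2 + 1 by ring, eisFour_add_one]
    simpa using hτ

lemma eisTriple_S (τ : ℍ) : eisTriple 0 (ModularGroup.S • τ) = τ ^ 4 * eisTriple 1 τ ∧
    eisTriple 1 (ModularGroup.S • τ) = τ ^ 4 * eisTriple 0 τ ∧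
    eisTriple 2 (ModularGroup.S • τ) = τ ^ 4 * eisTriple 2 τ := by
  have hτ : 0 < (τ : ℂ).im := τ.2
  have h0 : (τ : ℂ) ≠ 0 := ne_zero τ
  simp only [eisTriple, coe_S_smul]
  refine ⟨?_, ?_, ?_⟩
  · change 16 * eisFour (2 * -(τ : ℂ)⁻¹) = τ ^ 4 * eisFour (τ / 2)
    rw [show (2 * -(τ : ℂ)⁻¹) = -((τ : ℂ) / 2)⁻¹ by field_simp, eisFour_neg_inv (by simpa using hτ)]
    ring
  · change eisFour (-(τ : ℂ)⁻¹ / 2) = τ ^ 4 * (16 * eisFour (2 * τ))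
    rw [show (-(τ : ℂ)⁻¹ / 2) = -(2 * (τ : ℂ))⁻¹ by field_simp, eisFour_neg_inv (by simpa using hτ)]
    ring
  · change eisFour ((-(τ : ℂ)⁻¹ + 1) / 2) = τ ^ 4 * eisFour ((τ + 1) / 2)
    -- `(-τ⁻¹ + 1) / 2` is the image of `(τ + 1) / 2` under the matrix `(1, -1; 2, -1)`, which is
    -- `S T⁻² S T⁻¹` up to sign. Below, `u = T⁻¹ ((τ + 1) / 2)` and `T² S s = S u`.
    have h1 : (τ : ℂ) - 1 ≠ 0 := fun h => by
      have := congrArg Complex.im h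
      simp at this
      exact hτ.ne' this
    set u : ℂ := (τ - 1) / 2 with hu
    have hu0 : 0 < u.im := by simpa [hu] using hτ
    set s : ℂ := (-(τ : ℂ)⁻¹ + 1) / 2 with hs
    have hs0 : 0 < s.im := by
      have := (ModularGroup.S • τ : ℍ).2
      rw [coe_S_smul] at this
      simpa [hs] using this
    have hsu : -s⁻¹ + 1 + 1 = -u⁻¹ := by
      rw [hs, hu]
      have : -(τ : ℂ)⁻¹ + 1 = (τ - 1) / τ := by field_simp; ring
      rw [this]; field_simp; ring
    have h2 := eisFour_neg_inv hs0
    have hs1 : 0 < (-s⁻¹).im := by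
      have := im_inv_neg_coe_pos ⟨s, hs0⟩
      simpa [inv_neg] using this
    rw [← eisFour_add_one hs1, ← eisFour_add_one (by simpa using hs1), hsu, eisFour_neg_inv hu0,
      ← eisFour_add_one hu0, show u + 1 = (τ + 1) / 2 by rw [hu]; ring] at h2
    have h3 : u = τ * s := by rw [hu, hs]; field_simp; ring
    have h4 : s ≠ 0 := fun h => by simp [h] at hs0
    have h5 : s ^ 4 * eisFour s = s ^ 4 * (τ ^ 4 * eisFour ((τ + 1) / 2)) := by
      rw [← h2, h3]; ring
    exact mul_left_cancel₀ (pow_ne_zero 4 h4) h5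

lemma tendsto_affine_atImInfty {a : ℝ} (ha : 0 < a) (b : ℝ) :
    Tendsto (fun τ : ℍ => ofComplex (a * τ + b)) atImInfty atImInfty := by
  refine tendsto_comap_im_ofComplex.comp (tendsto_comap_iff.2 ?_)
  have : (Complex.im ∘ fun τ : ℍ => (a * τ + b : ℂ)) = fun τ : ℍ => a * τ.im := by
    ext τ; simp
  rw [this]
  exact Tendsto.const_mul_atTop ha tendsto_comap

lemma tendsto_E₄ : Tendsto ModularForm.E₄ atImInfty (𝓝 1) := by
  have h0 : cuspFunction 1 ModularForm.E₄ 0 = 1 := by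
    have h1 := EisensteinSeries.E_qExpansion_coeff_zero (k := 4) (by norm_num) ⟨2, rfl⟩
    rw [qExpansion_coeff] at h1
    simpa using h1
  have han : AnalyticAt ℂ (cuspFunction 1 ModularForm.E₄) 0 :=
    ModularFormClass.analyticAt_cuspFunction_zero _ one_pos one_mem_strictPeriods_SL
  have := han.continuousAt.tendsto.comp (qParam_tendsto_atImInfty one_pos)
  rw [h0] at this
  exact this.congr fun τ =>
    SlashInvariantFormClass.eq_cuspFunction _ τ one_mem_strictPeriods_SL one_ne_zero

lemma tendsto_eisTriple : Tendsto (eisTriple 0) atImInfty (𝓝 16) ∧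
    Tendsto (eisTriple 1) atImInfty (𝓝 1) ∧ Tendsto (eisTriple 2) atImInfty (𝓝 1) := by
  refine ⟨?_, ?_, ?_⟩
  · have := (tendsto_E₄.comp (tendsto_affine_atImInfty two_pos 0)).const_mul (16 : ℂ)
    rw [mul_one] at this
    refine this.congr fun τ => ?_
    simp [eisTriple, eisFour]
  · refine (tendsto_E₄.comp (tendsto_affine_atImInfty (half_pos one_pos) 0)).congr fun τ => ?_
    simp [eisTriple, eisFour, div_eq_inv_mul]
  · refine (tendsto_E₄.comp (tendsto_affine_atImInfty (half_pos one_pos) (1 / 2))).congr fun τ => ?_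
    simp [eisTriple, eisFour, div_eq_inv_mul, mul_add]

lemma eisTriple_bounded (j : Fin 3) : IsBoundedAtImInfty (eisTriple j) := by
  obtain ⟨h0, h1, h2⟩ := tendsto_eisTriple
  fin_cases j
  exacts [h0.isBigO_one ℝ, h1.isBigO_one ℝ, h2.isBigO_one ℝ]

lemma differentiableAt_eisFour {t : ℂ} (ht : 0 < t.im) : DifferentiableAt ℂ eisFour t :=
  (UpperHalfPlane.mdifferentiable_iff.1 (ModularFormClass.holo ModularForm.E₄) t ht).differentiableAt
    ((isOpen_lt continuous_const Complex.continuous_im).mem_nhds ht)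

lemma eisTriple_differentiableOn (j : Fin 3) :
    DifferentiableOn ℂ (eisTriple j ∘ ofComplex) {t | 0 < t.im} := by
  have key : DifferentiableOn ℂ
      (fun t : ℂ => ![16 * eisFour (2 * t), eisFour (t / 2), eisFour ((t + 1) / 2)] j)
      {t | 0 < t.im} := by
    intro t ht
    have ht' : 0 < t.im := ht
    apply DifferentiableAt.differentiableWithinAt
    fin_cases j
    · exact ((differentiableAt_eisFour (by simpa using ht')).comp t
        (by fun_prop : DifferentiableAt ℂ (fun t : ℂ => 2 * t) t)).const_mul 16
    · exact (differentiableAt_eisFour (by simpa using ht')).comp t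
        (by fun_prop : DifferentiableAt ℂ (fun t : ℂ => t / 2) t)
    · exact (differentiableAt_eisFour (by simpa using ht')).comp t
        (by fun_prop : DifferentiableAt ℂ (fun t : ℂ => (t + 1) / 2) t)
  refine key.congr fun t ht => ?_
  simp only [Function.comp, eisTriple, ofComplex_apply_of_im_pos ht]

/-- The product of the differences of the three modular forms. It is the determinant that decides
whether the generators adapted to `τ` are independent, see `gensAt_det`. -/
def eisVandermonde (τ : ℍ) : ℂ :=
  (eisTriple 0 τ - eisTriple 1 τ) * (eisTriple 0 τ - eisTriple 2 τ) *
    (eisTriple 2 τ - eisTriple 1 τ)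

/-- A holomorphic function that vanishes wherever the three modular forms are distinct is zero. -/
lemma eq_zero_of_eisVandermonde {f : ℍ → ℂ} (hf : DifferentiableOn ℂ (f ∘ ofComplex) {t | 0 < t.im})
    (h : ∀ τ, eisVandermonde τ ≠ 0 → f τ = 0) : f = 0 := by
  have he (j : Fin 3) := UpperHalfPlane.mdifferentiable_iff.2 (eisTriple_differentiableOn j)
  have hd (i j : Fin 3) := (he i).sub (he j)
  have hprod : f * ((eisTriple 0 - eisTriple 1) * (eisTriple 0 - eisTriple 2) *
      (eisTriple 2 - eisTriple 1)) = 0 := by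
    ext τ
    by_cases hτ : eisVandermonde τ = 0
    · exact mul_eq_zero_of_right _ hτ
    · exact mul_eq_zero_of_left (h τ hτ) _
  have hlim {i j : Fin 3} {a b : ℂ} (hi : Tendsto (eisTriple i) atImInfty (𝓝 a))
      (hj : Tendsto (eisTriple j) atImInfty (𝓝 b)) (h : eisTriple i - eisTriple j = 0) : a = b := by
    have h1 := hi.sub hj
    have h2 : (fun τ => eisTriple i τ - eisTriple j τ) = fun _ => 0 := h
    rw [h2] at h1
    exact sub_eq_zero.1 (tendsto_nhds_unique h1 tendsto_const_nhds)
  obtain ⟨t0, t1, t2⟩ := tendsto_eisTriple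
  have h01 : eisTriple 0 - eisTriple 1 ≠ 0 := fun h => by simpa using hlim t0 t1 h
  have h02 : eisTriple 0 - eisTriple 2 ≠ 0 := fun h => by simpa using hlim t0 t2 h
  have h21 : eisTriple 2 - eisTriple 1 ≠ 0 := fun h => h02 (by
    ext τ
    -- The difference `e 2 - e 1` tends to zero at the cusp, but `S` turns it into `e 2 - e 0`.
    obtain ⟨τ, rfl⟩ : ∃ τ', τ = ModularGroup.S • τ' := ⟨ModularGroup.S⁻¹ • τ, by simp⟩
    have := congrFun h τ
    simp only [Pi.sub_apply, Pi.zero_apply] at this ⊢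
    rw [(eisTriple_S τ).1, (eisTriple_S τ).2.2]
    linear_combination (-(τ : ℂ) ^ 4) * this)
  rw [UpperHalfPlane.mul_eq_zero_iff (UpperHalfPlane.mdifferentiable_iff.2 hf)
    (((hd 0 1).mul (hd 0 2)).mul (hd 2 1)),
    UpperHalfPlane.mul_eq_zero_iff ((hd 0 1).mul (hd 0 2)) (hd 2 1),
    UpperHalfPlane.mul_eq_zero_iff (hd 0 1) (hd 0 2)] at hprod
  tauto

/-! ### Invariance of the generators -/

lemma eval_esymmSq_one (z : Fin 4 → ℂ) : MvPolynomial.eval z (esymmSq 1) =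
    z 0 ^ 2 + z 1 ^ 2 + z 2 ^ 2 + z 3 ^ 2 := by
  simp [esymmSq_one]

lemma eval_esymmSq_two (z : Fin 4 → ℂ) : MvPolynomial.eval z (esymmSq 2) =
    z 0 ^ 2 * z 1 ^ 2 + z 0 ^ 2 * z 2 ^ 2 + z 0 ^ 2 * z 3 ^ 2 +
    z 1 ^ 2 * z 2 ^ 2 + z 1 ^ 2 * z 3 ^ 2 + z 2 ^ 2 * z 3 ^ 2 := by
  simp [esymmSq_two]

lemma eval_esymmSq_three (z : Fin 4 → ℂ) : MvPolynomial.eval z (esymmSq 3) =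
    z 0 ^ 2 * z 1 ^ 2 * z 2 ^ 2 + z 0 ^ 2 * z 1 ^ 2 * z 3 ^ 2 +
    z 0 ^ 2 * z 2 ^ 2 * z 3 ^ 2 + z 1 ^ 2 * z 2 ^ 2 * z 3 ^ 2 := by
  simp [esymmSq_three]

lemma eval_pfaffian (z : Fin 4 → ℂ) :
    MvPolynomial.eval z pfaffian = z 0 * z 1 * z 2 * z 3 := by
  simp [pfaffian]

lemma eval_quartic (z : Fin 4 → ℂ) : MvPolynomial.eval z quartic =
    (1 / 4) * MvPolynomial.eval z (esymmSq 1) ^ 2 - MvPolynomial.eval z (esymmSq 2) := by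
  simp only [quartic, map_sub, map_mul, map_pow, MvPolynomial.eval_C]

lemma eval_sextic (z : Fin 4 → ℂ) : MvPolynomial.eval z sextic =
    MvPolynomial.eval z (esymmSq 1) ^ 3 +
      2 * MvPolynomial.eval z (esymmSq 1) * MvPolynomial.eval z (esymmSq 2) -
      12 * MvPolynomial.eval z (esymmSq 3) := by
  simp only [sextic, map_sub, map_add, map_mul, map_pow, MvPolynomial.eval_C]
  rw [map_ofNat]

lemma wT_mulVec (z : Fin 4 → ℂ) :
    (wT : Matrix (Fin 4) (Fin 4) ℂ) *ᵥ z = ![z 0, z 1, z 2, -z 3] := by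
  ext i
  fin_cases i <;> simp [wT, mulVec, dotProduct, Fin.sum_univ_four]

lemma wS_mulVec (z : Fin 4 → ℂ) : (wS : Matrix (Fin 4) (Fin 4) ℂ) *ᵥ z =
    ![(z 0 + z 1 + z 2 - z 3) / 2, (z 0 + z 1 - z 2 + z 3) / 2, (z 0 - z 1 + z 2 + z 3) / 2,
      (-z 0 + z 1 + z 2 + z 3) / 2] := by
  ext i
  fin_cases i <;> simp [wS, mulVec, dotProduct, Fin.sum_univ_four] <;> ring

section Values

variable (z : Fin 4 → ℂ)

local notation "Tz" => (wT : Matrix (Fin 4) (Fin 4) ℂ) *ᵥ z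
local notation "Sz" => (wS : Matrix (Fin 4) (Fin 4) ℂ) *ᵥ z

lemma esymmSq_one_wT : MvPolynomial.eval Tz (esymmSq 1) = MvPolynomial.eval z (esymmSq 1) := by
  simp [wT_mulVec, eval_esymmSq_one]

lemma quartic_wT : MvPolynomial.eval Tz quartic = MvPolynomial.eval z quartic := by
  simp [wT_mulVec, eval_quartic, eval_esymmSq_one, eval_esymmSq_two]

lemma pfaffian_wT : MvPolynomial.eval Tz pfaffian = -MvPolynomial.eval z pfaffian := by
  simp [wT_mulVec, eval_pfaffian]

lemma sextic_wT : MvPolynomial.eval Tz sextic = MvPolynomial.eval z sextic := by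
  simp [wT_mulVec, eval_sextic, eval_esymmSq_one, eval_esymmSq_two, eval_esymmSq_three]

lemma esymmSq_one_wS : MvPolynomial.eval Sz (esymmSq 1) = MvPolynomial.eval z (esymmSq 1) := by
  simp [wS_mulVec, eval_esymmSq_one]
  ring

lemma quartic_wS : MvPolynomial.eval Sz quartic =
    -(1 / 2) * MvPolynomial.eval z quartic - 3 * MvPolynomial.eval z pfaffian := by
  simp [wS_mulVec, eval_quartic, eval_esymmSq_one, eval_esymmSq_two, eval_pfaffian]
  ring

lemma pfaffian_wS : MvPolynomial.eval Sz pfaffian =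
    -(1 / 4) * MvPolynomial.eval z quartic + (1 / 2) * MvPolynomial.eval z pfaffian := by
  simp [wS_mulVec, eval_quartic, eval_esymmSq_one, eval_esymmSq_two, eval_pfaffian]
  ring

lemma sextic_wS : MvPolynomial.eval Sz sextic = MvPolynomial.eval z sextic := by
  simp [wS_mulVec, eval_sextic, eval_esymmSq_one, eval_esymmSq_two, eval_esymmSq_three]
  ring

end Values

/-- A reflection in a root of `D₄` exchanges two coordinates, possibly with a change of both
signs. -/
lemma invariant_reflection {v : Fin 4 → ℂ} (hv : v ∈ rootsD4) (z : Fin 4 → ℂ) :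
    MvPolynomial.eval (reflectionMatrix v *ᵥ z) (esymmSq 1) = MvPolynomial.eval z (esymmSq 1) ∧
    MvPolynomial.eval (reflectionMatrix v *ᵥ z) (esymmSq 2) = MvPolynomial.eval z (esymmSq 2) ∧
    MvPolynomial.eval (reflectionMatrix v *ᵥ z) (esymmSq 3) = MvPolynomial.eval z (esymmSq 3) ∧
    MvPolynomial.eval (reflectionMatrix v *ᵥ z) pfaffian = MvPolynomial.eval z pfaffian := by
  have hr : reflectionMatrix v *ᵥ z = fun i => z i - v i * (v ⬝ᵥ z) := by
    rw [reflectionMatrix, hv.2, sub_mulVec, one_mulVec, div_self two_ne_zero, one_smul,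
      vecMulVec_mulVec]
    ext i
    simp [mul_comm]
  obtain ⟨h, h2⟩ := hv
  choose n hn using h
  have h3 : n 0 * n 0 + n 1 * n 1 + n 2 * n 2 + n 3 * n 3 = 2 := by
    simp only [dotProduct, Fin.sum_univ_four, hn] at h2; exact_mod_cast h2
  have hb (a b c d : ℤ) (h : a * a + b * b + c * c + d * d = 2) : a = -1 ∨ a = 0 ∨ a = 1 := by
    have h1 : -1 ≤ a := by nlinarith [sq_nonneg b, sq_nonneg c, sq_nonneg d]
    have h2 : a ≤ 1 := by nlinarith [sq_nonneg b, sq_nonneg c, sq_nonneg d]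
    omega
  have b0 := hb (n 0) (n 1) (n 2) (n 3) h3
  have b1 := hb (n 1) (n 0) (n 2) (n 3) (by linarith)
  have b2 := hb (n 2) (n 0) (n 1) (n 3) (by linarith)
  have b3 := hb (n 3) (n 0) (n 1) (n 2) (by linarith)
  simp only [hr, eval_esymmSq_one, eval_esymmSq_two, eval_esymmSq_three, eval_pfaffian, dotProduct,
    Fin.sum_univ_four, hn]
  generalize n 0 = a at *
  generalize n 1 = b at *
  generalize n 2 = c at *
  generalize n 3 = d at *
  rcases b0 with rfl | rfl | rfl <;> rcases b1 with rfl | rfl | rfl <;>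
    rcases b2 with rfl | rfl | rfl <;> rcases b3 with rfl | rfl | rfl <;>
    first
    | (exfalso; omega)
    | (push_cast; exact ⟨by ring, by ring, by ring, by ring⟩)

lemma isD4Invariant_of_reflection {P : MvPolynomial (Fin 4) ℂ}
    (h : ∀ v ∈ rootsD4, ∀ z, MvPolynomial.eval (reflectionMatrix v *ᵥ z) P =
      MvPolynomial.eval z P) : IsD4Invariant P := by
  intro g hg
  induction hg using Subgroup.closure_induction with
  | mem x hx =>
    obtain ⟨v, hv, hx⟩ := hx
    rw [hx]
    exact h v hv
  | one => simp
  | mul x y _ _ hx hy =>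
    intro z
    rw [Units.val_mul, ← mulVec_mulVec, hx, hy]
  | inv x _ hx =>
    intro z
    rw [← hx, mulVec_mulVec, ← Units.val_mul, mul_inv_cancel, Units.val_one, one_mulVec]

lemma isD4Invariant_gens (a b c d : ℂ) (i : Fin 4) : IsD4Invariant (gens a b c d i) := by
  refine isD4Invariant_of_reflection fun v hv z => ?_
  obtain ⟨h1, h2, h3, h4⟩ := invariant_reflection hv z
  fin_cases i
  · exact h1
  · simp [gens, eval_quartic, h1, h2, h4]
  · simp [gens, eval_quartic, h1, h2, h4]
  · simp [gens, eval_sextic, h1, h2, h3]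

/-! ### The transformation law -/

lemma act_mul (w w' : WF4) (z : Fin 4 → ℂ) : act (w * w') z = act w (act w' z) := by
  simp [act, mulVec_mulVec]

lemma act_one (z : Fin 4 → ℂ) : act 1 z = z := by simp [act]

lemma denom_mul (g h : SL(2, ℤ)) (τ : ℍ) :
    denom ((g * h : SL(2, ℤ)) : GL (Fin 2) ℝ) τ =
      denom (g : GL (Fin 2) ℝ) (h • τ : ℍ) * denom (h : GL (Fin 2) ℝ) τ := by
  have h1 := denom_cocycle_σ (g : GL (Fin 2) ℝ) h τ
  have h2 : σ (h : GL (Fin 2) ℝ) = ContinuousAlgEquiv.refl ℝ ℂ := by simp [σ]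
  rw [h2] at h1
  simpa using! h1

/-- The pairs for which the transformation law holds. -/
def transformSubgroup (k : ℤ) (φ : ℍ → (Fin 4 → ℂ) → ℂ) : Subgroup (SL(2, ℤ) × WF4) where
  carrier := {x | ∀ τ z, φ (x.1 • τ) (act x.2 z) = denom x.1 τ ^ k * φ τ z}
  one_mem' := by simp [act_one]
  mul_mem' {x y} hx hy τ z := by
    rw [Prod.fst_mul, Prod.snd_mul, mul_smul, act_mul, hx, hy, denom_mul, mul_zpow, mul_assoc]
  inv_mem' {x} hx τ z := by
    have h := hx (x.1⁻¹ • τ) (act x.2⁻¹ z)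
    have hd : denom ((x.1⁻¹ : SL(2, ℤ)) : GL (Fin 2) ℝ) τ *
        denom (x.1 : GL (Fin 2) ℝ) (x.1⁻¹ • τ : ℍ) = 1 := by
      rw [mul_comm, ← denom_mul, mul_inv_cancel]; simp
    rw [smul_inv_smul, ← act_mul, mul_inv_cancel, act_one] at h
    rw [Prod.fst_inv, Prod.snd_inv, h, ← mul_assoc, ← mul_zpow, hd, _root_.one_zpow, one_mul]

/-- The fibre product is generated by `(S, wS)`, `(T, wT)` and `1 × W(D₄)`. -/
lemma transform_of_generators {k : ℤ} {φ : ℍ → (Fin 4 → ℂ) → ℂ}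
    (hS : ∀ τ z, φ (ModularGroup.S • τ) (act sF4 z) = denom ModularGroup.S τ ^ k * φ τ z)
    (hT : ∀ τ z, φ (ModularGroup.T • τ) (act tF4 z) = denom ModularGroup.T τ ^ k * φ τ z)
    (hD : ∀ w : WF4, (w : GL (Fin 4) ℂ) ∈ WD4 → ∀ τ z, φ τ (act w z) = φ τ z) :
    ∀ x ∈ trialityGroup, ∀ τ z, φ (x.1 • τ) (act x.2 z) = denom x.1 τ ^ k * φ τ z := by
  intro x hx
  let K := transformSubgroup k φ ⊓ trialityGroup
  have hK : K.map (MonoidHom.fst _ _) = ⊤ := by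
    rw [eq_top_iff, ← SpecialLinearGroup.SL2Z_generators, Subgroup.closure_le]
    rintro g (rfl | rfl)
    · exact ⟨(ModularGroup.S, sF4), ⟨hS, mem_trialityGroup.2 trialityIso_S⟩, rfl⟩
    · exact ⟨(ModularGroup.T, tF4), ⟨hT, mem_trialityGroup.2 trialityIso_T⟩, rfl⟩
  obtain ⟨y, hy, hyx⟩ : x.1 ∈ K.map (MonoidHom.fst _ _) := hK ▸ Subgroup.mem_top _
  have hyx' : y.1 = x.1 := hyx
  suffices x ∈ transformSubgroup k φ from this
  have h1 : y⁻¹ * x ∈ transformSubgroup k φ := by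
    have h2 : (y⁻¹ * x).1 = 1 := by simp [hyx']
    have h3 : phi2 (y⁻¹ * x).2 = 1 := by
      rw [← mem_trialityGroup.1 (mul_mem (inv_mem hy.2) hx), h2, map_one, map_one]
    intro τ z
    rw [h2, hD _ (Subgroup.mem_subgroupOf.1 ((QuotientGroup.eq_one_iff _).1 h3))]
    simp
  simpa using mul_mem hy.1 h1

/-- The generators of the invariants of `W(D₄)` that are adapted to the point `τ`. With `v` the
`quartic` and `p` the `pfaffian`, the group `W(F₄) / W(D₄)` permutes the three quartics `u 0 = 2 v`,
`u 1 = -v - 6 p`, `u 2 = -v + 6 p` in the same way as `SL₂(ℤ)` permutes the modular forms `e j` of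
`eisTriple`. So `∑ e j u j` and `∑ e j ^ 2 u j` transform like modular forms of weights `4` and
`8`; these are the two middle generators. -/
def gensAt (τ : ℍ) : Fin 4 → MvPolynomial (Fin 4) ℂ :=
  gens (2 * eisTriple 0 τ - eisTriple 1 τ - eisTriple 2 τ) (6 * (eisTriple 2 τ - eisTriple 1 τ))
    (2 * eisTriple 0 τ ^ 2 - eisTriple 1 τ ^ 2 - eisTriple 2 τ ^ 2)
    (6 * (eisTriple 2 τ ^ 2 - eisTriple 1 τ ^ 2))

/-- The weights of the generators. -/
def genWeight : Fin 4 → ℤ := ![0, 4, 8, 0]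

lemma denom_S (τ : ℍ) : denom (ModularGroup.S : SL(2, ℤ)) τ = τ := ModularGroup.denom_S τ

lemma denom_T (τ : ℍ) : denom (ModularGroup.T : SL(2, ℤ)) τ = 1 := by
  rw [ModularGroup.denom_apply]; simp [ModularGroup.T]

lemma gensAt_transform (i : Fin 4) : ∀ x ∈ trialityGroup, ∀ τ z,
    MvPolynomial.eval (act x.2 z) (gensAt (x.1 • τ) i) =
      denom x.1 τ ^ genWeight i * MvPolynomial.eval z (gensAt τ i) := by
  refine transform_of_generators (φ := fun τ z => MvPolynomial.eval z (gensAt τ i))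
    (fun τ z => ?_) (fun τ z => ?_) fun w hw τ z => isD4Invariant_gens _ _ _ _ i _ hw z
  · obtain ⟨h0, h1, h2⟩ := eisTriple_S τ
    rw [denom_S, gensAt, h0, h1, h2, act]
    change MvPolynomial.eval ((wS : Matrix (Fin 4) (Fin 4) ℂ) *ᵥ z) _ = _
    fin_cases i
    · simp [gens, gensAt, genWeight, esymmSq_one_wS]
    · simp [gens, gensAt, genWeight, quartic_wS, pfaffian_wS]
      norm_cast
      ring
    · simp [gens, gensAt, genWeight, quartic_wS, pfaffian_wS]
      norm_cast
      ring
    · simp [gens, gensAt, genWeight, sextic_wS]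
  · obtain ⟨h0, h1, h2⟩ := eisTriple_T τ
    rw [denom_T, gensAt, h0, h1, h2, act]
    change MvPolynomial.eval ((wT : Matrix (Fin 4) (Fin 4) ℂ) *ᵥ z) _ = _
    fin_cases i
    · simp [gens, gensAt, esymmSq_one_wT]
    · simp [gens, gensAt, quartic_wT, pfaffian_wT]
      ring
    · simp [gens, gensAt, quartic_wT, pfaffian_wT]
      ring
    · simp [gens, gensAt, sextic_wT]

/-! ### Triality invariants built from the generators -/

lemma bounded_eval {σ : Type*} {y : ℍ → σ → ℂ} (hy : ∀ i, IsBoundedAtImInfty fun τ => y τ i)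
    (P : MvPolynomial σ ℂ) : IsBoundedAtImInfty fun τ => MvPolynomial.eval (y τ) P := by
  induction P using MvPolynomial.induction_on with
  | C r => simpa using! const_boundedAtFilter atImInfty r
  | add p q hp hq =>
    simp only [map_add]
    exact BoundedAtFilter.add hp hq
  | mul_X p i hp =>
    simp only [map_mul, MvPolynomial.eval_X]
    exact BoundedAtFilter.mul hp (hy i)

lemma bounded_polynomial_eval {y : ℍ → ℂ} (hy : IsBoundedAtImInfty y) (P : Polynomial ℂ) :
    IsBoundedAtImInfty fun τ => P.eval (y τ) := by
  induction P using Polynomial.induction_on' with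
  | add p q hp hq =>
    simp only [Polynomial.eval_add]
    exact BoundedAtFilter.add hp hq
  | monomial n a =>
    simp only [Polynomial.eval_monomial]
    refine BoundedAtFilter.mul (const_boundedAtFilter atImInfty a) ?_
    induction n with
    | zero => simpa using! const_boundedAtFilter atImInfty (1 : ℂ)
    | succ n ih =>
      simp only [pow_succ]
      exact BoundedAtFilter.mul ih hy

lemma eval_smul_of_isHomogeneous {P : MvPolynomial (Fin 4) ℂ} {n : ℕ} (hP : P.IsHomogeneous n)
    (c : ℂ) (z : Fin 4 → ℂ) :
    MvPolynomial.eval (c • z) P = c ^ n * MvPolynomial.eval z P := by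
  rw [MvPolynomial.eval_eq', MvPolynomial.eval_eq', Finset.mul_sum]
  refine Finset.sum_congr rfl fun d hd => ?_
  have hn : ∑ i, d i = n := by
    have := hP (MvPolynomial.mem_support_iff.1 hd)
    rw [Finsupp.weight_apply, Finsupp.sum_fintype _ _ (by simp)] at this
    simpa using this
  simp only [Pi.smul_apply, smul_eq_mul, mul_pow, Finset.prod_mul_distrib]
  rw [Finset.prod_pow_eq_pow_sum, hn]
  ring

/-- The discriminant as a modular form. -/
def discForm : ModularForm 𝒮ℒ 12 := CuspForm.toModularFormₗ CuspForm.discriminant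

lemma exp_mul_discForm_bounded :
    IsBoundedAtImInfty fun τ : ℍ => discForm τ * Complex.exp (-(Real.pi * Complex.I * τ)) := by
  have h := CuspFormClass.exp_decay_atImInfty (h := 1) CuspForm.discriminant one_pos
    one_mem_strictPeriods_SL
  have h1 : (fun τ : ℍ => Complex.exp (-(Real.pi * Complex.I * τ))) =O[atImInfty]
      fun τ : ℍ => Real.exp (Real.pi * τ.im) := by
    refine Asymptotics.IsBigO.of_norm_le fun τ => ?_
    rw [Complex.norm_exp]
    simp
  refine (h.mul h1).trans (Asymptotics.IsBigO.of_bound 1 (Eventually.of_forall fun τ => ?_))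
  rw [← Real.exp_add, Real.norm_eq_abs, Real.abs_exp]
  simp
  nlinarith [Real.pi_pos, τ.im_pos]

/-- The triality invariant `Δ ^ m ∏ (g i) ^ (e i)` of degree `m`. The factor `Δ ^ m` is there for
the cusp condition: it compensates the growth of `q ^ (-1/2)`. -/
def monomialInvariant {m : ℕ} (e : Exponents m) (τ : ℍ) (z : Fin 4 → ℂ) : ℂ :=
  discForm τ ^ m * ∏ i, MvPolynomial.eval z (gensAt τ i) ^ e.1 i

/-- The weight of `monomialInvariant e`. -/
def monomialWeight {m : ℕ} (e : Exponents m) : ℤ := 12 * m + ∑ i, genWeight i * e.1 i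

/-- By homogeneity each coordinate of `z` absorbs one factor `Δ`. -/
lemma monomialInvariant_eq_smul {m : ℕ} (e : Exponents m) (τ : ℍ) (z : Fin 4 → ℂ) :
    monomialInvariant e τ z =
      ∏ i, MvPolynomial.eval (discForm τ • z) (gensAt τ i) ^ e.1 i := by
  have h (i : Fin 4) : MvPolynomial.eval (discForm τ • z) (gensAt τ i) =
      discForm τ ^ genDegree i * MvPolynomial.eval z (gensAt τ i) :=
    eval_smul_of_isHomogeneous (isHomogeneous_gens _ _ _ _ i) _ _
  simp only [h, mul_pow, Finset.prod_mul_distrib, ← pow_mul]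
  rw [Finset.prod_pow_eq_pow_sum, e.2, monomialInvariant]

lemma differentiable_eval (P : MvPolynomial (Fin 4) ℂ) :
    Differentiable ℂ fun z : Fin 4 → ℂ => MvPolynomial.eval z P := fun z =>
  (AnalyticOnNhd.eval_mvPolynomial P z (Set.mem_univ z)).differentiableAt

lemma gensAt_differentiableOn (i : Fin 4) : DifferentiableOn ℂ
    (fun p : ℂ × (Fin 4 → ℂ) => MvPolynomial.eval p.2 (gensAt (ofComplex p.1) i))
    {p | 0 < p.1.im} := by
  have he (j : Fin 3) : DifferentiableOn ℂ
      (fun p : ℂ × (Fin 4 → ℂ) => eisTriple j (ofComplex p.1)) {p | 0 < p.1.im} :=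
    (eisTriple_differentiableOn j).comp differentiableOn_fst fun p hp => hp
  have hP (P : MvPolynomial (Fin 4) ℂ) : DifferentiableOn ℂ
      (fun p : ℂ × (Fin 4 → ℂ) => MvPolynomial.eval p.2 P) {p | 0 < p.1.im} :=
    ((differentiable_eval P).comp differentiable_snd).differentiableOn
  have h0 := he 0
  have h1 := he 1
  have h2 := he 2
  have hq := hP quartic
  have hp := hP pfaffian
  fin_cases i
  · exact hP _
  · simp [gensAt, gens]
    fun_prop
  · simp [gensAt, gens]
    fun_prop
  · exact hP _

lemma bounded_eval_gensAt {y : ℍ → Fin 4 → ℂ} (hy : ∀ i, IsBoundedAtImInfty fun τ => y τ i)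
    (i : Fin 4) : IsBoundedAtImInfty fun τ => MvPolynomial.eval (y τ) (gensAt τ i) := by
  have hc (r : ℂ) : IsBoundedAtImInfty fun _ : ℍ => r := const_boundedAtFilter atImInfty r
  have h0 := eisTriple_bounded 0
  have h1 := eisTriple_bounded 1
  have h2 := eisTriple_bounded 2
  have hq := bounded_eval hy quartic
  have hp := bounded_eval hy pfaffian
  have hsub {f g : ℍ → ℂ} (hf : IsBoundedAtImInfty f) (hg : IsBoundedAtImInfty g) :
      IsBoundedAtImInfty (f - g) := (boundedAtImInftySubalgebra ℂ).sub_mem hf hg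
  fin_cases i
  · exact bounded_eval hy _
  · simp only [gensAt, gens]
    simp
    exact ((hsub (hsub ((hc 2).mul h0) h1) h2).mul hq).add (((hc 6).mul (hsub h2 h1)).mul hp)
  · simp only [gensAt, gens]
    simp
    simp only [pow_two]
    exact ((hsub (hsub ((hc 2).mul (h0.mul h0)) (h1.mul h1)) (h2.mul h2)).mul hq).add
      (((hc 6).mul (hsub (h2.mul h2) (h1.mul h1))).mul hp)
  · exact bounded_eval hy _

lemma isTrialityInvariant_monomialInvariant {m : ℕ} (e : Exponents m) :
    IsTrialityInvariant (monomialWeight e) m (monomialInvariant e) := by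
  have h1 : DifferentiableOn ℂ
      (fun p : ℂ × (Fin 4 → ℂ) => monomialInvariant e (ofComplex p.1) p.2) {p | 0 < p.1.im} := by
    refine ((modularForm_differentiableOn discForm).pow m).mul ?_
    have hg (i : Fin 4) := (gensAt_differentiableOn i).fun_pow (e.1 i)
    simp only [Fin.prod_univ_four]
    exact (((hg 0).mul (hg 1)).mul (hg 2)).mul (hg 3)
  have h2 : ∀ x ∈ trialityGroup, ∀ τ z, monomialInvariant e (x.1 • τ) (act x.2 z) =
      denom x.1 τ ^ monomialWeight e * monomialInvariant e τ z := by
    intro x hx τ z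
    have hd := denom_ne_zero (x.1 : GL (Fin 2) ℝ) τ
    simp only [monomialInvariant, modularForm_transform, gensAt_transform _ x hx, mul_pow,
      Finset.prod_mul_distrib]
    have h3 : ∏ i, (denom (x.1 : GL (Fin 2) ℝ) τ ^ genWeight i) ^ e.1 i =
        denom (x.1 : GL (Fin 2) ℝ) τ ^ ∑ i, genWeight i * e.1 i := by
      rw [Fin.prod_univ_four, Fin.sum_univ_four]
      simp only [zpow_add₀ hd, _root_.zpow_mul, _root_.zpow_natCast]
    rw [h3, monomialWeight, zpow_add₀ hd, _root_.zpow_mul, _root_.zpow_natCast]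
    ring
  refine ⟨h1, fun τ => ?_, h2, fun z₁ z₂ z₃ Λ hΛ => tendsto_of_bounded h1 h2 _ _ _ _ ?_⟩
  · refine ⟨MvPolynomial.C (discForm τ ^ m) * ∏ i, gensAt τ i ^ e.1 i, ?_, fun z => ?_⟩
    · refine MvPolynomial.IsHomogeneous.C_mul ?_ _
      have := isHomogeneous_prod_gens (2 * eisTriple 0 τ - eisTriple 1 τ - eisTriple 2 τ)
        (6 * (eisTriple 2 τ - eisTriple 1 τ))
        (2 * eisTriple 0 τ ^ 2 - eisTriple 1 τ ^ 2 - eisTriple 2 τ ^ 2)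
        (6 * (eisTriple 2 τ ^ 2 - eisTriple 1 τ ^ 2)) e.1
      rwa [e.2] at this
    · simp [monomialInvariant, map_prod]
  · simp only [monomialInvariant_eq_smul]
    have hb : ∀ i, IsBoundedAtImInfty fun τ : ℍ => (discForm τ •
        ![z₁, z₂, z₃, Complex.exp (-(Real.pi * Complex.I * τ)) * Λ]) i := by
      have hc (r : ℂ) : IsBoundedAtImInfty fun τ : ℍ => discForm τ * r :=
        (modularForm_bounded discForm).mul (const_boundedAtFilter atImInfty r)
      intro i
      fin_cases i
      · exact hc z₁
      · exact hc z₂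
      · exact hc z₃
      · refine (exp_mul_discForm_bounded.mul (const_boundedAtFilter atImInfty Λ)).congr
          (fun τ => ?_) fun _ => rfl
        simp [mul_assoc]
    have : (fun τ : ℍ => ∏ i, MvPolynomial.eval (discForm τ •
        ![z₁, z₂, z₃, Complex.exp (-(Real.pi * Complex.I * τ)) * Λ]) (gensAt τ i) ^ e.1 i) =
        ∏ i, (fun τ : ℍ => MvPolynomial.eval (discForm τ •
        ![z₁, z₂, z₃, Complex.exp (-(Real.pi * Complex.I * τ)) * Λ]) (gensAt τ i)) ^ e.1 i := by
      ext τ; simp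
    rw [this]
    exact (boundedAtImInftySubalgebra ℂ).prod_mem fun i _ =>
      (boundedAtImInftySubalgebra ℂ).pow_mem (bounded_eval_gensAt hb i) _

/-- `monomialInvariant e` as an element of `R_{*,m}`. -/
def monomialElt {m : ℕ} (e : Exponents m) : invariants m (monomialWeight e) :=
  ⟨monomialInvariant e, isTrialityInvariant_monomialInvariant e⟩

lemma gensAt_det (τ : ℍ) : (2 * eisTriple 0 τ - eisTriple 1 τ - eisTriple 2 τ) *
      (6 * (eisTriple 2 τ ^ 2 - eisTriple 1 τ ^ 2)) - (6 * (eisTriple 2 τ - eisTriple 1 τ)) *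
      (2 * eisTriple 0 τ ^ 2 - eisTriple 1 τ ^ 2 - eisTriple 2 τ ^ 2) =
    -12 * eisVandermonde τ := by
  rw [eisVandermonde]; ring

/-! ### The pairing of triality invariants -/

lemma natDegree_aeval_le {σ : Type*} (f : σ → Polynomial ℂ) (hf : ∀ i, (f i).natDegree ≤ 1)
    {P : MvPolynomial σ ℂ} {m : ℕ} (hP : P.IsHomogeneous m) :
    (MvPolynomial.aeval f P).natDegree ≤ m := by
  rw [P.as_sum, map_sum]
  refine Polynomial.natDegree_sum_le_of_forall_le _ _ fun d hd => ?_
  have hn : ∑ i ∈ d.support, d i = m := by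
    have := hP (MvPolynomial.mem_support_iff.1 hd)
    rw [Finsupp.weight_apply, Finsupp.sum] at this
    simpa using this
  rw [MvPolynomial.aeval_monomial, Polynomial.algebraMap_eq]
  refine (Polynomial.natDegree_C_mul_le _ _).trans ((Polynomial.natDegree_prod_le _ _).trans ?_)
  rw [← hn]
  refine Finset.sum_le_sum fun i _ => (Polynomial.natDegree_pow_le).trans ?_
  simpa using Nat.mul_le_mul_left (d i) (hf i)

/-- At a fixed point `y` a triality invariant is bounded at the cusp. The cusp condition bounds the
polynomial `s ↦ φ(τ, y₀, y₁, y₂, q ^ (-1/2) s)` of degree at most `m` at the points `1, …, m + 1`,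
and Lagrange interpolation recovers its value at `s = q ^ (1/2) y₃` from these values. -/
lemma IsTrialityInvariant.bounded_apply {k : ℤ} {m : ℕ} {φ : ℍ → (Fin 4 → ℂ) → ℂ}
    (h : IsTrialityInvariant k m φ) (y : Fin 4 → ℂ) : IsBoundedAtImInfty fun τ => φ τ y := by
  let s : Finset ℕ := Finset.range (m + 1)
  let v : ℕ → ℂ := fun j => (j : ℂ) + 1
  have hv : Set.InjOn v s := fun i _ j _ hij => by simpa [v] using hij
  have key : (fun τ : ℍ => φ τ y) = ∑ j ∈ s, fun τ : ℍ =>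
      φ τ ![y 0, y 1, y 2, Complex.exp (-(Real.pi * Complex.I * τ)) * v j] *
        (Lagrange.basis s v j).eval (y 3 * Complex.exp (Real.pi * Complex.I * τ)) := by
    ext τ
    obtain ⟨P, hP, hφ⟩ := h.poly τ
    set t := Complex.exp (-(Real.pi * Complex.I * τ)) with ht
    have htt : t * Complex.exp (Real.pi * Complex.I * τ) = 1 := by
      rw [ht, ← Complex.exp_add]; simp
    let f : Fin 4 → Polynomial ℂ :=
      ![Polynomial.C (y 0), Polynomial.C (y 1), Polynomial.C (y 2), Polynomial.C t * Polynomial.X]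
    have hf : ∀ i, (f i).natDegree ≤ 1 := by
      intro i
      fin_cases i
      · simp [f]
      · simp [f]
      · simp [f]
      · exact (Polynomial.natDegree_C_mul_le _ _).trans Polynomial.natDegree_X_le
    have hdeg : (MvPolynomial.aeval f P).degree < s.card := by
      rw [Finset.card_range]
      refine lt_of_le_of_lt Polynomial.degree_le_natDegree ?_
      exact_mod_cast Nat.lt_succ_of_le (natDegree_aeval_le f hf hP)
    have heval (r : ℂ) : (MvPolynomial.aeval f P).eval r = φ τ ![y 0, y 1, y 2, t * r] := by
      rw [hφ, ← Polynomial.coe_aeval_eq_eval, MvPolynomial.comp_aeval_apply,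
        ← MvPolynomial.coe_aeval_eq_eval, RingHom.coe_coe]
      congr 2
      ext i
      fin_cases i <;> simp [f]
    have hL := congrArg (Polynomial.eval (y 3 * Complex.exp (Real.pi * Complex.I * τ)))
      (Lagrange.eq_interpolate hv hdeg)
    rw [heval, Lagrange.interpolate_apply, Polynomial.eval_finsetSum] at hL
    have hy : ![y 0, y 1, y 2, t * (y 3 * Complex.exp (Real.pi * Complex.I * τ))] = y := by
      have : t * (y 3 * Complex.exp (Real.pi * Complex.I * τ)) = y 3 := by
        linear_combination y 3 * htt
      rw [this]
      ext i; fin_cases i <;> rfl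
    rw [hy] at hL
    simp only [Finset.sum_apply]
    rw [hL]
    simp only [Polynomial.eval_mul, Polynomial.eval_C, heval]
    rfl
  have hq : IsBoundedAtImInfty fun τ : ℍ => Complex.exp (Real.pi * Complex.I * τ) := by
    refine isBoundedAtImInfty_iff.2 ⟨1, 0, fun τ _ => ?_⟩
    rw [Complex.norm_exp, Real.exp_le_one_iff]
    simp
    positivity
  rw [key]
  refine (boundedAtImInftySubalgebra ℂ).sum_mem fun j _ => ?_
  have hvj : v j ≠ 0 := Nat.cast_add_one_ne_zero j
  exact (h.bounded (y 0) (y 1) (y 2) hvj).mul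
    (bounded_polynomial_eval ((const_boundedAtFilter atImInfty (y 3)).mul hq) _)

/-- The points of `ℂ⁴` with coordinates in `{0, …, m}`. -/
def grid (m : ℕ) : Finset (Fin 4 → ℂ) :=
  Fintype.piFinset fun _ => (Finset.range (m + 1)).image Nat.cast

/-- The sum of the values of a function over the images of the grid under the subgroup of
`W(F₄)` generated by `wS` and `wT`, a complement of `W(D₄)`. -/
def orbitSum (m : ℕ) (F : (Fin 4 → ℂ) → ℂ) : ℂ :=
  ∑ i, ∑ y ∈ grid m, F (act (word sF4 tF4 i) y)

lemma sF4_mul_self : sF4 * sF4 = 1 := Subtype.ext wS_mul_self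

lemma tF4_mul_self : tF4 * tF4 = 1 := Subtype.ext wT_mul_self

lemma braid_F4 : sF4 * tF4 * sF4 = tF4 * sF4 * tF4 := by
  refine Subtype.ext (Units.ext ?_)
  simp only [sF4, tF4, Subgroup.coe_mul, Units.val_mul]
  ext i j
  fin_cases i <;> fin_cases j <;>
    simp [wS, wT, mul_apply, Fin.sum_univ_four] <;> norm_num

lemma orbitSum_act (m : ℕ) (F : (Fin 4 → ℂ) → ℂ) (j : Fin 6) :
    orbitSum m (fun z => F (act (word sF4 tF4 j) z)) = orbitSum m F := by
  have hb : Function.Bijective (wordTable j) := by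
    revert j; decide
  simp only [orbitSum, ← act_mul, word_mul sF4_mul_self tF4_mul_self braid_F4]
  exact hb.sum_comp fun i => ∑ y ∈ grid m, F (act (word sF4 tF4 i) y)

/-- The pairing `orbitSum (φ ψ)` of two triality invariants, as a function of `τ`. -/
def pairingFun (m : ℕ) (φ ψ : ℍ → (Fin 4 → ℂ) → ℂ) (τ : ℍ) : ℂ :=
  orbitSum m fun z => φ τ z * ψ τ z

lemma pairingFun_transform {m : ℕ} {k l : ℤ} {φ ψ : ℍ → (Fin 4 → ℂ) → ℂ}
    (hφ : IsTrialityInvariant k m φ) (hψ : IsTrialityInvariant l m ψ) {g : SL(2, ℤ)} {j : Fin 6}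
    (hg : (g, word sF4 tF4 j) ∈ trialityGroup) (τ : ℍ) :
    pairingFun m φ ψ (g • τ) = denom g τ ^ (k + l) * pairingFun m φ ψ τ := by
  rw [pairingFun, ← orbitSum_act m _ j, zpow_add₀ (denom_ne_zero _ τ)]
  have h1 := hφ.transform _ hg τ
  have h2 := hψ.transform _ hg τ
  simp only at h1 h2
  simp only [h1, h2, pairingFun, orbitSum, Finset.mul_sum]
  refine Finset.sum_congr rfl fun i _ => Finset.sum_congr rfl fun y _ => ?_
  ring

/-- Every class of `W(F₄) / W(D₄)` has a representative that permutes the terms of `orbitSum`. -/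
lemma pairingFun_slash {m : ℕ} {k l : ℤ} {φ ψ : ℍ → (Fin 4 → ℂ) → ℂ}
    (hφ : IsTrialityInvariant k m φ) (hψ : IsTrialityInvariant l m ψ) :
    ∀ γ : SL(2, ℤ), pairingFun m φ ψ ∣[k + l] γ = pairingFun m φ ψ := by
  have key (g : SL(2, ℤ)) (j : Fin 6) (hg : (g, word sF4 tF4 j) ∈ trialityGroup) :
      pairingFun m φ ψ ∣[k + l] g = pairingFun m φ ψ := by
    ext τ
    rw [ModularForm.SL_slash_apply, pairingFun_transform hφ hψ hg, mul_comm (_ ^ _), mul_assoc,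
      ← zpow_add₀ (denom_ne_zero _ τ)]
    simp
  exact SlashInvariantForm.slash_action_generators_SL2Z
    (key _ 1 (mem_trialityGroup.2 trialityIso_S)) (key _ 2 (mem_trialityGroup.2 trialityIso_T))

lemma IsTrialityInvariant.differentiableOn_apply {k : ℤ} {m : ℕ} {φ : ℍ → (Fin 4 → ℂ) → ℂ}
    (h : IsTrialityInvariant k m φ) (y : Fin 4 → ℂ) :
    DifferentiableOn ℂ ((fun τ => φ τ y) ∘ ofComplex) {t | 0 < t.im} :=
  h.holo.comp (f := fun t : ℂ => (t, y))
    (differentiableOn_id.prodMk (differentiableOn_const y)) fun _ ht => ht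

lemma pairingFun_differentiableOn {m : ℕ} {k l : ℤ} {φ ψ : ℍ → (Fin 4 → ℂ) → ℂ}
    (hφ : IsTrialityInvariant k m φ) (hψ : IsTrialityInvariant l m ψ) :
    DifferentiableOn ℂ (pairingFun m φ ψ ∘ ofComplex) {t | 0 < t.im} :=
  DifferentiableOn.fun_sum (u := Finset.univ) (A := fun (i : Fin 6) (t : ℂ) => ∑ y ∈ grid m,
    φ (ofComplex t) (act (word sF4 tF4 i) y) * ψ (ofComplex t) (act (word sF4 tF4 i) y)) fun _ _ =>
    DifferentiableOn.fun_sum fun _ _ =>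
      (hφ.differentiableOn_apply _).fun_mul (hψ.differentiableOn_apply _)

lemma pairingFun_bounded {m : ℕ} {k l : ℤ} {φ ψ : ℍ → (Fin 4 → ℂ) → ℂ}
    (hφ : IsTrialityInvariant k m φ) (hψ : IsTrialityInvariant l m ψ) :
    IsBoundedAtImInfty (pairingFun m φ ψ) := by
  have : pairingFun m φ ψ = ∑ i, ∑ y ∈ grid m, (fun τ => φ τ (act (word sF4 tF4 i) y)) *
      fun τ => ψ τ (act (word sF4 tF4 i) y) := by
    ext τ; simp [pairingFun, orbitSum]
  rw [this]
  exact (boundedAtImInftySubalgebra ℂ).sum_mem fun i _ =>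
    (boundedAtImInftySubalgebra ℂ).sum_mem fun y _ =>
      (hφ.bounded_apply _).mul (hψ.bounded_apply _)

/-- The pairing of two triality invariants is a modular form. -/
def pairing {m : ℕ} {k l : ℤ} (φ : invariants m k) (ψ : invariants m l) :
    ModularForm 𝒮ℒ (k + l) where
  toFun := pairingFun m φ.1 ψ.1
  slash_action_eq' := fun _ ⟨γ, hγ⟩ => hγ ▸ pairingFun_slash φ.2 ψ.2 γ
  holo' := UpperHalfPlane.mdifferentiable_iff.2 (pairingFun_differentiableOn φ.2 ψ.2)
  bdd_at_cusps' {c} hc := by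
    rw [Subgroup.IsArithmetic.isCusp_iff_isCusp_SL2Z] at hc
    rw [OnePoint.isBoundedAt_iff_forall_SL2Z hc]
    intro γ _
    rw [pairingFun_slash φ.2 ψ.2 γ]
    exact pairingFun_bounded φ.2 ψ.2

lemma pairing_apply {m : ℕ} {k l : ℤ} (φ : invariants m k) (ψ : invariants m l) (τ : ℍ) :
    pairing φ ψ τ = pairingFun m φ.1 ψ.1 τ := rfl

lemma IsTrialityInvariant.isD4Invariant {k : ℤ} {m : ℕ} {φ : ℍ → (Fin 4 → ℂ) → ℂ}
    (h : IsTrialityInvariant k m φ) {τ : ℍ} {P : MvPolynomial (Fin 4) ℂ}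
    (hP : ∀ z, φ τ z = MvPolynomial.eval z P) : IsD4Invariant P := by
  intro g hg z
  let w : WF4 := ⟨g, WD4_le_WF4 hg⟩
  have hw : ((1 : SL(2, ℤ)), w) ∈ trialityGroup := by
    rw [mem_trialityGroup, map_one, map_one]
    exact ((QuotientGroup.eq_one_iff w).2 (Subgroup.mem_subgroupOf.2 hg)).symm
  have := h.transform _ hw τ z
  rw [← hP, ← hP]
  simpa using! this

open ComplexConjugate in
lemma eval_map_conj (P : MvPolynomial (Fin 4) ℂ) {z : Fin 4 → ℂ} (hz : ∀ i, conj (z i) = z i) :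
    MvPolynomial.eval z (P.map (starRingEnd ℂ)) = conj (MvPolynomial.eval z P) := by
  rw [MvPolynomial.eval_map, MvPolynomial.eval₂_eq', MvPolynomial.eval_eq', map_sum]
  simp [hz]

lemma conj_act_word {z : Fin 4 → ℂ} (hz : ∀ i, starRingEnd ℂ (z i) = z i) (j : Fin 6) (i : Fin 4) :
    starRingEnd ℂ (act (word sF4 tF4 j) z i) = act (word sF4 tF4 j) z i := by
  have hS {z : Fin 4 → ℂ} (hz : ∀ i, starRingEnd ℂ (z i) = z i) (i : Fin 4) :
      starRingEnd ℂ (act sF4 z i) = act sF4 z i := by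
    change starRingEnd ℂ (((wS : Matrix (Fin 4) (Fin 4) ℂ) *ᵥ z) i) =
      ((wS : Matrix (Fin 4) (Fin 4) ℂ) *ᵥ z) i
    have h2 : starRingEnd ℂ 2 = 2 := Complex.conj_ofNat 2
    rw [wS_mulVec]
    fin_cases i <;> simp [hz, h2]
  have hT {z : Fin 4 → ℂ} (hz : ∀ i, starRingEnd ℂ (z i) = z i) (i : Fin 4) :
      starRingEnd ℂ (act tF4 z i) = act tF4 z i := by
    change starRingEnd ℂ (((wT : Matrix (Fin 4) (Fin 4) ℂ) *ᵥ z) i) =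
      ((wT : Matrix (Fin 4) (Fin 4) ℂ) *ᵥ z) i
    rw [wT_mulVec]
    fin_cases i <;> simp [hz]
  fin_cases j
  · simpa [word, act_one] using hz i
  · exact hS hz i
  · exact hT hz i
  · simpa [word, act_mul] using hS (hT hz) i
  · simpa [word, act_mul] using hT (hS hz) i
  · simpa [word, act_mul] using hS (hT (hS hz)) i

/-- The elements of `W(D₄)` are real matrices, so conjugation of the coefficients preserves
invariance. -/
lemma IsD4Invariant.map_conj {P : MvPolynomial (Fin 4) ℂ} (hP : IsD4Invariant P) :
    IsD4Invariant (P.map (starRingEnd ℂ)) := by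
  intro g hg z
  have hconj (z : Fin 4 → ℂ) : MvPolynomial.eval z (P.map (starRingEnd ℂ)) =
      starRingEnd ℂ (MvPolynomial.eval (star z) P) := by
    rw [MvPolynomial.eval_map, MvPolynomial.eval₂_eq', MvPolynomial.eval_eq', map_sum]
    simp
  have hg' : star ((g : Matrix (Fin 4) (Fin 4) ℂ) *ᵥ z) =
      (g : Matrix (Fin 4) (Fin 4) ℂ) *ᵥ star z := by
    ext i
    simp only [mulVec, dotProduct, Pi.star_apply, star_sum, star_mul']
    refine Finset.sum_congr rfl fun j _ => ?_
    obtain ⟨n, hn⟩ := WD4_integral hg i j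
    rw [hn]
    simp
  rw [hconj, hconj, hg', hP g hg]

/-- A homogeneous polynomial of degree `m` that vanishes on the grid is zero. -/
lemma eq_zero_of_grid {m : ℕ} {P : MvPolynomial (Fin 4) ℂ} (hP : P.IsHomogeneous m)
    (h : ∀ y ∈ grid m, MvPolynomial.eval y P = 0) : P = 0 := by
  refine MvPolynomial.eq_zero_of_eval_zero_at_prod_finset P
    (fun _ => (Finset.range (m + 1)).image Nat.cast) (fun i => ?_)
    fun x hx => h x (Fintype.mem_piFinset.2 hx)
  rw [Finset.card_image_of_injective _ Nat.cast_injective, Finset.card_range]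
  exact Nat.lt_succ_of_le ((P.degreeOf_le_totalDegree i).trans hP.totalDegree_le)

/-- The pairing is nondegenerate at a point where the three modular forms are distinct: there the
polynomial whose coefficients are conjugate to those of `φ τ` is a combination of the
`monomialInvariant e τ`, and the pairing of `φ τ` with this polynomial is a sum of squares of
absolute values, because the points of the grid and their images under `wS` and `wT` are real. -/
lemma eq_zero_of_pairingFun_eq_zero {k : ℤ} {m : ℕ} {φ : ℍ → (Fin 4 → ℂ) → ℂ}
    (hφ : IsTrialityInvariant k m φ) {τ : ℍ} (hτ : eisVandermonde τ ≠ 0)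
    (h : ∀ e : Exponents m, pairingFun m φ (monomialInvariant e) τ = 0) (z : Fin 4 → ℂ) :
    φ τ z = 0 := by
  obtain ⟨P, hP, hPφ⟩ := hφ.poly τ
  have hdet := gensAt_det τ
  have hne : -12 * eisVandermonde τ ≠ 0 := mul_ne_zero (by norm_num) hτ
  rw [← hdet] at hne
  obtain ⟨r, hr⟩ := (hφ.isD4Invariant hPφ).map_conj.exists_sum_prod_gens hne (hP.map _)
  have hΔ : discForm τ ^ m ≠ 0 := pow_ne_zero _ (ModularForm.discriminant_ne_zero τ)
  have h1 : orbitSum m (fun z => MvPolynomial.eval z P *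
      MvPolynomial.eval z (P.map (starRingEnd ℂ))) = 0 := by
    have h2 : discForm τ ^ m * orbitSum m (fun z => MvPolynomial.eval z P *
        MvPolynomial.eval z (P.map (starRingEnd ℂ))) =
        ∑ e, r e * pairingFun m φ (monomialInvariant e) τ := by
      simp only [pairingFun, orbitSum, Finset.mul_sum, hr, map_sum, map_mul, map_prod, map_pow,
        MvPolynomial.eval_C, monomialInvariant, hPφ]
      conv_rhs => rw [Finset.sum_comm]
      refine Finset.sum_congr rfl fun j _ => ?_
      conv_rhs => rw [Finset.sum_comm]
      refine Finset.sum_congr rfl fun y _ => Finset.sum_congr rfl fun e _ => ?_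
      simp only [gensAt]
      ring
    simp only [h, mul_zero, Finset.sum_const_zero] at h2
    exact (mul_eq_zero.1 h2).resolve_left hΔ
  have h3 : ∀ j : Fin 6, ∀ y ∈ grid m,
      MvPolynomial.eval (act (word sF4 tF4 j) y) P = 0 := by
    have h4 : ∑ j, ∑ y ∈ grid m,
        Complex.normSq (MvPolynomial.eval (act (word sF4 tF4 j) y) P) = 0 := by
      have : ((∑ j, ∑ y ∈ grid m,
          Complex.normSq (MvPolynomial.eval (act (word sF4 tF4 j) y) P) : ℝ) : ℂ) = 0 := by
        rw [← h1, orbitSum]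
        push_cast
        refine Finset.sum_congr rfl fun j _ => Finset.sum_congr rfl fun y hy => ?_
        have hy' (i : Fin 4) : starRingEnd ℂ (y i) = y i := by
          obtain ⟨n, -, hn⟩ := Finset.mem_image.1 (Fintype.mem_piFinset.1 hy i)
          rw [← hn]; simp
        rw [eval_map_conj P (conj_act_word hy' j), Complex.mul_conj]
      exact_mod_cast this
    intro j y hy
    have h5 := (Finset.sum_eq_zero_iff_of_nonneg fun j _ =>
      Finset.sum_nonneg fun y _ => Complex.normSq_nonneg _).1 h4 j (Finset.mem_univ j)
    exact Complex.normSq_eq_zero.1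
      ((Finset.sum_eq_zero_iff_of_nonneg fun y _ => Complex.normSq_nonneg _).1 h5 y hy)
  have hP0 : P = 0 := eq_zero_of_grid hP fun y hy => by
    simpa [word, act_one] using h3 0 y hy
  rw [hPφ, hP0, map_zero]

/-- The pairings with the `monomialInvariant e` determine a triality invariant. -/
lemma eq_zero_of_pairing_eq_zero {k : ℤ} {m : ℕ} {φ : invariants m k}
    (h : ∀ e : Exponents m, pairing φ (monomialElt e) = 0) : φ = 0 := by
  refine Subtype.ext (funext₂ fun τ z => ?_)
  exact congrFun (eq_zero_of_eisVandermonde (φ.2.differentiableOn_apply z) fun τ hτ =>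
    eq_zero_of_pairingFun_eq_zero φ.2 hτ (fun e => DFunLike.congr_fun (h e) τ) z) τ

/-- The `monomialInvariant e` satisfy no linear relation whose coefficients are holomorphic
functions. -/
lemma eq_zero_of_sum_monomialInvariant {m : ℕ} {f : Exponents m → ℍ → ℂ}
    (hf : ∀ e, DifferentiableOn ℂ (f e ∘ ofComplex) {t | 0 < t.im})
    (h : ∀ τ z, ∑ e, f e τ * monomialInvariant e τ z = 0) (e : Exponents m) : f e = 0 := by
  refine eq_zero_of_eisVandermonde (hf e) fun τ hτ => ?_
  have hne : -12 * eisVandermonde τ ≠ 0 := mul_ne_zero (by norm_num) hτ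
  rw [← gensAt_det τ] at hne
  refine congrFun (eq_zero_of_sum_prod_gens_eq_zero hne (fun e => f e τ) ?_) e
  apply MvPolynomial.funext
  intro z
  have hΔ : discForm τ ^ m ≠ 0 := pow_ne_zero _ (ModularForm.discriminant_ne_zero τ)
  refine mul_left_cancel₀ hΔ ?_
  rw [map_zero, mul_zero, ← h τ z, map_sum, Finset.mul_sum]
  refine Finset.sum_congr rfl fun e _ => ?_
  rw [map_mul, map_prod, MvPolynomial.eval_C, monomialInvariant]
  simp only [map_pow, gensAt]
  ring

/-! ### The rank -/

/-- Pairing with a fixed invariant, as an additive map. -/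
def pairingHom {m : ℕ} (k : ℤ) {l : ℤ} (ψ : invariants m l) :
    invariants m k →+ ModularForm 𝒮ℒ (k + l) where
  toFun φ := pairing φ ψ
  map_zero' := by
    ext τ
    simp [pairing_apply, pairingFun, orbitSum]
  map_add' φ φ' := by
    ext τ
    simp [pairing_apply, pairingFun, orbitSum, add_mul, Finset.sum_add_distrib]

lemma modularForm_of_ext {k l : ℤ} (h : k = l) {f : ModularForm 𝒮ℒ k} {g : ModularForm 𝒮ℒ l}
    (hfg : ∀ τ, f τ = g τ) : (DirectSum.of (fun k : ℤ => ModularForm 𝒮ℒ k) k f) =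
      DirectSum.of (fun k : ℤ => ModularForm 𝒮ℒ k) l g := by
  subst h
  congr 1
  exact DFunLike.ext _ _ hfg

/-- Pairing with a fixed homogeneous invariant, as a linear map over the ring of modular forms. -/
def pairingMap {m : ℕ} {l : ℤ} (ψ : invariants m l) : InvariantModule m →ₗ[ModularRing] ModularRing :=
  { DirectSum.toAddMonoid fun k =>
      (DirectSum.of (fun k : ℤ => ModularForm 𝒮ℒ k) (k + l)).comp (pairingHom k ψ) with
    map_smul' := by
      intro a x
      change DirectSum.toAddMonoid (fun k => (DirectSum.of (fun k : ℤ => ModularForm 𝒮ℒ k)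
        (k + l)).comp (pairingHom k ψ)) (a • x) = a • DirectSum.toAddMonoid (fun k =>
        (DirectSum.of (fun k : ℤ => ModularForm 𝒮ℒ k) (k + l)).comp (pairingHom k ψ)) x
      induction a using DirectSum.induction_on with
      | zero => simp
      | add a b ha hb => rw [add_smul, map_add, ha, hb, add_smul]
      | of i f =>
        induction x using DirectSum.induction_on with
        | zero => simp
        | add x y hx hy => rw [smul_add, map_add, hx, hy, map_add, smul_add]
        | of j φ =>
          rw [DirectSum.Gmodule.of_smul_of, DirectSum.toAddMonoid_of, DirectSum.toAddMonoid_of,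
            smul_eq_mul, AddMonoidHom.comp_apply, AddMonoidHom.comp_apply, DirectSum.of_mul_of]
          refine modularForm_of_ext (add_assoc i j l) fun τ => ?_
          change pairingFun m (fun τ z => f τ * φ.1 τ z) ψ.1 τ = f τ * pairingFun m φ.1 ψ.1 τ
          simp only [pairingFun, orbitSum, Finset.mul_sum, mul_assoc] }

lemma pairingMap_apply {m : ℕ} {l : ℤ} (ψ : invariants m l) (x : InvariantModule m) (k : ℤ) :
    pairingMap ψ x (k + l) = pairing (x k) ψ := by
  change (DirectSum.toAddMonoid (fun k => (DirectSum.of (fun k : ℤ => ModularForm 𝒮ℒ k)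
    (k + l)).comp (pairingHom k ψ)) x : ModularRing) (k + l) = pairingHom k ψ (x k)
  induction x using DirectSum.induction_on with
  | zero => simp
  | add x y hx hy => simp [hx, hy]
  | of i φ =>
    rw [DirectSum.toAddMonoid_of, AddMonoidHom.comp_apply]
    rcases eq_or_ne i k with rfl | hik
    · rw [DirectSum.of_eq_same, DirectSum.of_eq_same]
    · rw [DirectSum.of_eq_of_ne _ _ _ (by omega), DirectSum.of_eq_of_ne _ _ _ (by omega), map_zero]

lemma smul_of_apply {m : ℕ} {l : ℤ} (ψ : invariants m l) (a : ModularRing) (k : ℤ) (τ : ℍ)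
    (z : Fin 4 → ℂ) :
    ((a • DirectSum.of (fun k : ℤ => invariants m k) l ψ : InvariantModule m) k).1 τ z =
      a (k - l) τ * ψ.1 τ z := by
  obtain ⟨i, rfl⟩ : ∃ i, k = i + l := ⟨k - l, by ring⟩
  have hil : ∀ j, j = i → a j τ = a i τ := by rintro _ rfl; rfl
  rw [hil _ (add_sub_cancel_right i l)]
  clear hil
  induction a using DirectSum.induction_on with
  | zero => simp
  | add a b ha hb =>
    rw [add_smul, DirectSum.add_apply, DirectSum.add_apply, Submodule.coe_add, Pi.add_apply,
      Pi.add_apply, ha, hb]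
    exact (add_mul _ _ _).symm
  | of j f =>
    rw [DirectSum.Gmodule.of_smul_of]
    rcases eq_or_ne j i with rfl | hij
    · rw [DirectSum.of_eq_same]
      change ((DirectSum.of (fun k : ℤ => invariants m k) (j + l) (modularSMul f ψ)) (j + l)).1 τ z
        = _
      rw [DirectSum.of_eq_same, modularSMul_apply]
    · change ((DirectSum.of (fun k : ℤ => invariants m k) (j + l) (modularSMul f ψ)) (i + l)).1 τ z
        = _
      rw [DirectSum.of_eq_of_ne _ _ _ (by omega), DirectSum.of_eq_of_ne _ _ _ (by omega)]
      simp

/-- The value at a point of the component of weight `k`. -/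
def componentEval (m : ℕ) (k : ℤ) (τ : ℍ) (z : Fin 4 → ℂ) : InvariantModule m →+ ℂ where
  toFun x := (x k).1 τ z
  map_zero' := by simp
  map_add' x y := by simp

instance : Nontrivial ModularRing := by
  refine ⟨⟨1, 0, fun h => ?_⟩⟩
  have h0 := congrArg (fun a : ModularRing => a 0 I) h
  have h1 : (1 : ModularRing) 0 = (1 : ModularForm 𝒮ℒ 0) := DirectSum.of_eq_same _ _
  simp [h1] at h0

/-- The family of the `monomialInvariant e` is linearly independent, so the rank is at least their
number. -/
lemma linearIndependent_monomialElt (m : ℕ) : LinearIndependent ModularRing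
    fun e : Exponents m => (DirectSum.of (fun k : ℤ => invariants m k) _ (monomialElt e) :
      InvariantModule m) := by
  refine Fintype.linearIndependent_iffₛ.2 fun g g' hg e => ?_
  refine DFinsupp.ext fun i => DFunLike.ext _ _ fun τ => sub_eq_zero.1 ?_
  -- In the component of weight `i + monomialWeight e` of a relation, the coefficient of the invariant
  -- with exponents `e'` is the component of weight `w e'` of its coefficient in the relation.
  let w (e' : Exponents m) : ℤ := i + monomialWeight e - monomialWeight e'
  have hw (a : ModularRing) : a (w e) τ = a i τ := by
    have : ∀ j, j = i → a j τ = a i τ := by rintro _ rfl; rfl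
    exact this _ (add_sub_cancel_right i (monomialWeight e))
  have h1 := eq_zero_of_sum_monomialInvariant
    (f := fun e' τ => (g e' (w e') - g' e' (w e')) τ)
    (fun e' => UpperHalfPlane.mdifferentiable_iff.1
      (ModularFormClass.holo (g e' (w e') - g' e' (w e')))) (fun τ z => ?_) e
  · rw [← hw, ← hw]
    exact congrFun h1 τ
  · have h2 := congrArg (componentEval m (i + monomialWeight e) τ z) hg
    rw [map_sum, map_sum, ← sub_eq_zero, ← Finset.sum_sub_distrib] at h2
    rw [← h2]
    refine Finset.sum_congr rfl fun e' _ => ?_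
    change _ = ((g e' • DirectSum.of (fun k : ℤ => invariants m k) _ (monomialElt e') :
      InvariantModule m) (i + monomialWeight e)).1 τ z - ((g' e' •
      DirectSum.of (fun k : ℤ => invariants m k) _ (monomialElt e') :
      InvariantModule m) (i + monomialWeight e)).1 τ z
    rw [smul_of_apply, smul_of_apply, ← sub_mul]
    rfl

/-- The rank of `R_{*,m}` is the number of monomials of degree `m` in the generators. The upper
bound comes from the injection into a free module that is given by the pairings with the
`monomialInvariant e`. -/
theorem rank_invariantModule (m : ℕ) :
    Module.rank ModularRing (InvariantModule m) = (Fintype.card (Exponents m) : Cardinal) := by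
  apply le_antisymm
  · let F : InvariantModule m →ₗ[ModularRing] (Exponents m → ModularRing) :=
      LinearMap.pi fun e => pairingMap (monomialElt e)
    have hF : Function.Injective F := by
      intro x y hxy
      refine DFinsupp.ext fun k => sub_eq_zero.1 (eq_zero_of_pairing_eq_zero fun e => ?_)
      have h1 : pairing (x k) (monomialElt e) = pairing (y k) (monomialElt e) := by
        rw [← pairingMap_apply, ← pairingMap_apply]
        exact congrArg (fun a : ModularRing => a (k + monomialWeight e)) (congrFun hxy e)
      exact ((pairingHom k (monomialElt e)).map_sub _ _).trans (sub_eq_zero.2 h1)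
    have := LinearMap.rank_le_of_injective F hF
    rwa [rank_fun'] at this
  · have := (linearIndependent_monomialElt m).cardinal_le_rank
    rwa [Cardinal.mk_fintype] at this

/-! ### The generating function -/

section GeneratingFunction

open PowerSeries

/-- The geometric series `∑ x ^ (w n)`. -/
def geomSeries (w : ℕ) : PowerSeries ℤ := PowerSeries.mk fun n => if w ∣ n then 1 else 0

lemma geomSeries_mul {w : ℕ} (hw : 0 < w) : geomSeries w * (1 - X ^ w) = 1 := by
  ext n
  rw [mul_sub, mul_one, map_sub, coeff_mul_X_pow', geomSeries, coeff_mk, coeff_one]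
  by_cases hn : w ≤ n
  · rw [if_pos hn, coeff_mk, if_neg (by omega : ¬ n = 0)]
    obtain ⟨k, rfl⟩ := Nat.exists_eq_add_of_le hn
    simp
  · rw [if_neg hn, sub_zero]
    congr 1
    rw [eq_iff_iff]
    exact ⟨fun h => Nat.eq_zero_of_dvd_of_lt h (by omega), fun h => h ▸ dvd_zero w⟩

/-- The coefficient of a product of geometric series counts the `l` with sum `m` whose entries are
divisible by the degrees, and division by the degrees turns these into exponents. -/
lemma card_exponents (m : ℕ) :
    (Fintype.card (Exponents m) : ℤ) = coeff m (∏ i, geomSeries (genDegree i)) := by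
  classical
  have hpos (i : Fin 4) : 0 < genDegree i := by fin_cases i <;> simp [genDegree]
  rw [coeff_prod]
  have h1 (l : Fin 4 →₀ ℕ) : ∏ i, coeff (l i) (geomSeries (genDegree i)) =
      if ∀ i, genDegree i ∣ l i then (1 : ℤ) else 0 := by
    simp only [geomSeries, coeff_mk, Finset.prod_ite_zero, Finset.prod_const_one, Finset.mem_univ,
      forall_true_left]
  simp only [h1]
  rw [Finset.sum_boole, ← Finset.card_univ]
  congr 1
  refine Finset.card_bij (fun e _ => Finsupp.equivFunOnFinite.symm fun i => genDegree i * e.1 i)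
    (fun e _ => ?_) (fun e _ e' _ h => ?_) fun l hl => ?_
  · rw [Finset.mem_filter, Finset.mem_finsuppAntidiag]
    refine ⟨⟨?_, Finset.subset_univ _⟩, fun i => ?_⟩
    · simpa using e.2
    · simp
  · refine Subtype.ext (Finsupp.ext fun i => ?_)
    have := DFunLike.congr_fun h i
    exact Nat.eq_of_mul_eq_mul_left (hpos i) (by simpa using this)
  · rw [Finset.mem_filter, Finset.mem_finsuppAntidiag] at hl
    have h2 (i : Fin 4) : genDegree i * (l i / genDegree i) = l i := Nat.mul_div_cancel' (hl.2 i)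
    refine ⟨⟨Finsupp.equivFunOnFinite.symm fun i => l i / genDegree i, ?_⟩, Finset.mem_univ _, ?_⟩
    · simpa [h2] using hl.1.1
    · ext i
      simp [h2]

lemma mk_card_exponents_mul : (PowerSeries.mk fun m => (Fintype.card (Exponents m) : ℤ)) *
    ((1 - X ^ 2) * (1 - X ^ 4) ^ 2 * (1 - X ^ 6)) = 1 := by
  have h : (PowerSeries.mk fun m => (Fintype.card (Exponents m) : ℤ)) =
      ∏ i, geomSeries (genDegree i) := by
    ext m
    rw [coeff_mk, card_exponents]
  have h2 := geomSeries_mul (w := 2) two_pos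
  have h4 := geomSeries_mul (w := 4) four_pos
  have h6 := geomSeries_mul (w := 6) (by norm_num)
  rw [h, Fin.prod_univ_four]
  change geomSeries 2 * geomSeries 4 * geomSeries 4 * geomSeries 6 * _ = 1
  calc _ = (geomSeries 2 * (1 - X ^ 2)) * (geomSeries 4 * (1 - X ^ 4)) ^ 2 *
      (geomSeries 6 * (1 - X ^ 6)) := by ring
    _ = 1 := by rw [h2, h4, h6]; simp

end GeneratingFunction

end Triality

end

/-- The module of `D₄` triality invariants of degree `m` has a finite rank `r m` over the ring of
modular forms, and `∑ r m x ^ m = 1 / ((1 - x ^ 2) (1 - x ^ 4) ^ 2 (1 - x ^ 6))`. -/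
theorem mainTheorem7 : ∃ r : ℕ → ℕ,
    (∀ m : ℕ, Module.rank Triality.ModularRing (Triality.InvariantModule m) = (r m : Cardinal)) ∧
    (PowerSeries.mk fun m => (r m : ℤ)) *
      ((1 - PowerSeries.X ^ 2) * (1 - PowerSeries.X ^ 4) ^ 2 * (1 - PowerSeries.X ^ 6)) = 1 :=
  ⟨fun m => Fintype.card (Triality.Exponents m), Triality.rank_invariantModule,
    Triality.mk_card_exponents_mul⟩
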